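/- **Setting.** Let $d\ge 2$, let $\Omega\subset\mathbb{R}^d$ be a bounded domain (nonempty, open, connected) with strongly Lipschitz boundary (locally the subgraph of a Lipschitz function), and let $q=d/(d-1)$. For $u\in L^q(\Omega)$ let $$\operatorname{TV}(u,\Omega)=\sup\Big\{\int_\Omega u\,\operatorname{div}\psi\,\mathrm dx \;\Big|\; \psi\in C^1_c(\Omega;\mathbb{R}^d),\ \sup_{x\in\Omega}|\psi(x)|\le 1\Big\}\in[0,\infty].$$ Let $V\subset L^q(\Omega)$ be a weakly closed linear subspace containing the constant function $\mathbb 1_\Omega$. For $u\in V$ put $a_u=\frac{1}{|\Omega|}\int_\Omega u\,\mathrm dx$ and $\mathring u=u-a_u\mathbb 1_\Omega$. Let $$B_{\mathring V}=\Big\{u\in V \;\Big|\; \operatorname{TV}(u,\Omega)\le 1,\ \int_\Omega u\,\mathrm dx=0\Big\},$$ and let $\operatorname{Ext}(B_{\mathring V})$ be the set of its extremal points. Let $Y$ be a separable real Hilbert space, let $K:V\to Y$ be a continuous linear operator that is (sequentially) continuous from the weak topology of $L^q(\Omega)$ to the strong topology of $Y$, and let $F:Y\to[0,\infty)$ be strictly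 convex and three times continuously Fréchet differentiable. Assume that for every $y\in Y$ the function $c\mapsto F(y+c\,K\mathbb 1_\Omega)$ has exactly one minimizer over $c\in\mathbb{R}$. Let $K^*:Y\to V'$ be the adjoint of $K$, and for $p\in V'$, $v\in V$ write $\int_\Omega p\,v\,\mathrm dx$ for the duality pairing $\langle p,v\rangle$, and $\int_\Omega p\,\mathrm dx:=\langle p,\mathbb 1_\Omega\rangle$. Consider the problem $$\min_{u\in V}\ J(u):=F(Ku)+\operatorname{TV}(u,\Omega).\tag{P}$$ **Theorem.** Let $\bar u\in V$ and $\bar p=-K^*\nabla F(K\bar u)\in V'$. The following are equivalent: 1. $\bar u$ is a solution of (P), i.e. $J(\bar u)\le J(u)$ for all $u\in V$. 2. $\int_\Omega\bar p\,\mathrm dx=0$, $\ \int_\Omega\bar p\,\bar u\,\mathrm dx=\operatorname{TV}(\bar u,\Omega)$, and $\int_\Omega\bar p\,u\,\mathrm dx\le 1$ for all $u\in B_{\mathring V}$. 3. $\int_\Omega\bar p\,\mathrm dx=0$, $\ \int_\Omega\bar p\,\mathring{\bar u}\,\mathrm dx=\operatorname{TV}(\mathring{\bar u},\Omega)$, and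 $\int_\Omega\bar p\,u\,\mathrm dx\le 1$ for all $u\in\operatorname{Ext}(B_{\mathring V})$. -/

import Mathlib

open MeasureTheory Filter Topology Set
open scoped ENNReal NNReal

noncomputable section

/-- A bounded domain (nonempty, open, connected set) of `ℝ^d` with strongly Lipschitz boundary:
near every boundary point `x` there are a unit vector `ν` and a Lipschitz function `g` such that
`Ω` coincides near `x` with the strict subgraph, in direction `ν`, of `g` over the hyperplane
orthogonal to `ν` (`y - ⟪ν, y⟫ ν` is the orthogonal projection of `y` to that hyperplane). -/
structure LipschitzDomain (d : ℕ) where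
  carrier : Set (EuclideanSpace ℝ (Fin d))
  isOpen : IsOpen carrier
  isConnected : IsConnected carrier
  isBounded : Bornology.IsBounded carrier
  lipschitz_boundary : ∀ x ∈ frontier carrier,
    ∃ (ν : EuclideanSpace ℝ (Fin d)) (g : EuclideanSpace ℝ (Fin d) → ℝ) (C : ℝ≥0),
      ‖ν‖ = 1 ∧ LipschitzWith C g ∧
        ∀ᶠ y in 𝓝 x, (y ∈ carrier ↔ inner ℝ ν y < g (y - (inner ℝ ν y : ℝ) • ν))

namespace LipschitzDomain

variable {d : ℕ} (Ω : LipschitzDomain d)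

/-- Lebesgue measure on `Ω`. -/
def vol : Measure (EuclideanSpace ℝ (Fin d)) := volume.restrict Ω.carrier

instance : IsFiniteMeasure Ω.vol :=
  ⟨by simpa [vol] using Ω.isBounded.measure_lt_top⟩

/-- The divergence `∑ i, ∂ᵢ ψᵢ`. -/
def divergence (ψ : EuclideanSpace ℝ (Fin d) → EuclideanSpace ℝ (Fin d))
    (x : EuclideanSpace ℝ (Fin d)) : ℝ :=
  ∑ i : Fin d, fderiv ℝ ψ x (EuclideanSpace.single i 1) i

/-- Test fields for the total variation: `ψ ∈ C¹_c(Ω; ℝ^d)` (extended by zero) with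
`sup |ψ| ≤ 1`, `|·|` the Euclidean norm. -/
def IsTestField (ψ : EuclideanSpace ℝ (Fin d) → EuclideanSpace ℝ (Fin d)) : Prop :=
  ContDiff ℝ 1 ψ ∧ HasCompactSupport ψ ∧ tsupport ψ ⊆ Ω.carrier ∧ ∀ x, ‖ψ x‖ ≤ 1

/-- The isotropic total variation `TV(u, Ω) ∈ [0, ∞]`, which is `∞` when `u` is not in `BV(Ω)`. -/
def TV (u : EuclideanSpace ℝ (Fin d) → ℝ) : EReal :=
  ⨆ (ψ : EuclideanSpace ℝ (Fin d) → EuclideanSpace ℝ (Fin d)) (_ : Ω.IsTestField ψ),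
    ((∫ x, u x * divergence ψ x ∂Ω.vol : ℝ) : EReal)

variable {Ω} {q : ℝ≥0∞} [Fact (1 ≤ q)] {V : Submodule ℝ (Lp ℝ q Ω.vol)}

/-- The constant function `𝟙_Ω` as an element of the control space `V`. -/
def oneV (h1 : Lp.const q Ω.vol (1 : ℝ) ∈ V) : V := ⟨Lp.const q Ω.vol (1 : ℝ), h1⟩

/-- The mean-free part `u - a_u 𝟙_Ω` of `u ∈ V`, where `a_u` is the mean of `u` over `Ω`. -/
def center (h1 : Lp.const q Ω.vol (1 : ℝ) ∈ V) (u : V) : V :=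
  u - (⨍ x, (u : Lp ℝ q Ω.vol) x ∂Ω.vol) • oneV h1

/-- The zero-mean total variation unit ball `{u ∈ V | TV(u, Ω) ≤ 1, ∫_Ω u = 0}`. -/
def tvBall (V : Submodule ℝ (Lp ℝ q Ω.vol)) : Set V :=
  {u : V | Ω.TV (u : Lp ℝ q Ω.vol) ≤ 1 ∧ ∫ x, (u : Lp ℝ q Ω.vol) x ∂Ω.vol = 0}

variable {Y : Type*} [NormedAddCommGroup Y] [InnerProductSpace ℝ Y]

/-- Sequential weak-to-strong continuity of `K` on `V`, with the weak topology of `L^q(Ω)`. -/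
def IsWeakToStrongContinuous (K : V →L[ℝ] Y) : Prop :=
  ∀ (u : ℕ → V) (u₀ : V),
    Tendsto (fun n => toWeakSpace ℝ (Lp ℝ q Ω.vol) (u n : Lp ℝ q Ω.vol)) atTop
      (𝓝 (toWeakSpace ℝ (Lp ℝ q Ω.vol) (u₀ : Lp ℝ q Ω.vol))) →
    Tendsto (fun n => K (u n)) atTop (𝓝 (K u₀))

/-- The objective `J(u) = F(K u) + TV(u, Ω)` on `V`. -/
def objective (F : Y → ℝ) (K : V →L[ℝ] Y) (u : V) : EReal :=
  (F (K u) : EReal) + Ω.TV (u : Lp ℝ q Ω.vol)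

/-- `ubar ∈ V` solves the problem of minimizing `J` over `V`. -/
def IsSolution (F : Y → ℝ) (K : V →L[ℝ] Y) (ubar : V) : Prop :=
  ∀ u : V, objective F K ubar ≤ objective F K u

/-- The adjoint `K* : Y → V'`, characterized by the duality pairing `(K* y) v = (y, K v)_Y`. -/
def adjointOp (K : V →L[ℝ] Y) (y : Y) : StrongDual ℝ V := (innerSL ℝ y).comp K

/-- The dual variable `-K* ∇F(K ubar) ∈ V'`. -/
def dualVariable [CompleteSpace Y] (F : Y → ℝ) (K : V →L[ℝ] Y) (ubar : V) : StrongDual ℝ V :=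
  -adjointOp K (gradient F (K ubar))

end LipschitzDomain

end

/-! The equivalence of 1 and 2 is convex analysis. `F` is convex and differentiable, and TV is a
convex, positively homogeneous functional that does not see constants. Minimality of `ubar` is the
variational inequality `p (v - ubar) ≤ TV v - TV ubar` for the dual variable `p`. Since TV is
homogeneous and invariant under constants, this says that `p` kills constants, is dominated by TV,
and attains TV at `ubar`; conversely, these properties and the gradient inequality for `F` give
minimality (`isSolution_iff`). Centering changes neither TV nor `p`, so 2 implies 3.

The substance is 3 implies 2: a bound on the extreme points of the TV ball must extend to the whole
ball. This is Krein-Milman, once the ball is weakly compact in `L^q`. It is convex and closed, so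
two facts remain: `L^q` is reflexive for `1 < q < ∞`, and the ball is bounded in norm.

Reflexivity comes from the representation of the dual of `L^p` by Radon-Nikodym
(`exists_lpDuality_eq`); with Banach-Alaoglu it yields `le_of_forall_extremePoints_le`.

Boundedness is the Sobolev-Poincaré inequality for functions of bounded variation at the critical
exponent `d/(d-1)` (`exists_sobolev_poincare`). It uses only directional variations and the interior
cone condition of a Lipschitz domain. Mollification turns bounded variation into an `L¹` bound for
translates. From it, `L¹` control spreads from a small ball over compact subsets by connectedness
and up to the boundary along cones. For the critical exponent, `u` is shifted into the domain,
mollified and cut off near a boundary point. The result is dominated by integrals of its derivatives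
along a basis of directions inside the cone, to which the Gagliardo-Nirenberg grid-lines inequality
applies. No extension operator is needed. -/

/-! ### The dual of `L^p` on a finite measure space. -/

section LpDual

variable {α : Type*} [MeasurableSpace α] {μ : Measure α} [IsFiniteMeasure μ]

theorem sum_apply_indicatorConstLp {p : ℝ≥0∞} [Fact (1 ≤ p)] (ℓ : Lp ℝ p μ →L[ℝ] ℝ)
    {f : ℕ → Set α} (hf : ∀ i, MeasurableSet (f i)) (hd : Pairwise (Function.onFun Disjoint f))
    (s : Finset ℕ) :
    ∑ i ∈ s, ℓ (indicatorConstLp p (hf i) (measure_ne_top μ _) 1) =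
      ℓ (indicatorConstLp p (s.measurableSet_biUnion fun i _ => hf i) (measure_ne_top μ _) 1) := by
  classical
  induction s using Finset.induction_on with
  | empty =>
    have : indicatorConstLp p ((∅ : Finset ℕ).measurableSet_biUnion fun i _ => hf i)
        (measure_ne_top μ _) (1 : ℝ) = 0 := by
      simp only [Finset.notMem_empty, iUnion_of_empty, iUnion_empty]
      exact indicatorConstLp_empty
    rw [this]
    simp
  | insert a s ha ih =>
    rw [Finset.sum_insert ha, ih, ← map_add, ← indicatorConstLp_disjoint_union]
    · congr 2
      ext x; simp
    · rw [Set.disjoint_iUnion₂_right]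
      intro i hi
      exact hd (by rintro rfl; exact ha hi)

/-- The signed measure `A ↦ ℓ (𝟙_A)` of a continuous linear functional `ℓ` on `L^p`. -/
noncomputable def dualSignedMeasure {p : ℝ≥0∞} [Fact (1 ≤ p)] (hp : p ≠ ∞)
    (ℓ : Lp ℝ p μ →L[ℝ] ℝ) : SignedMeasure α := by
  classical
  exact
  { measureOf' := fun A => if h : MeasurableSet A then
      ℓ (indicatorConstLp p h (measure_ne_top μ A) 1) else 0
    empty' := by
      simp only [MeasurableSet.empty, dif_pos]
      rw [indicatorConstLp_empty, map_zero]
    not_measurable' := fun A hA => by simp [hA]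
    m_iUnion' := fun f hf hd => by
      simp only [hf, dif_pos, MeasurableSet.iUnion hf]
      unfold HasSum
      simp_rw [sum_apply_indicatorConstLp ℓ hf hd]
      refine (ℓ.continuous.tendsto _).comp ?_
      -- For `p < ∞` it suffices that the symmetric differences have measure tending to zero; they
      -- lie in the union of the remaining sets, whose measure is at most a tail of a convergent
      -- series.
      refine tendsto_indicatorConstLp_set hp ?_
      have hsum : ∑' i, μ (f i) ≠ ∞ := by
        rw [← measure_iUnion hd hf]; exact measure_ne_top _ _
      refine tendsto_of_tendsto_of_tendsto_of_le_of_le tendsto_const_nhds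
        (ENNReal.tendsto_tsum_compl_atTop_zero hsum) (fun _ => zero_le) fun s => ?_
      refine le_trans (measure_mono ?_)
        (measure_iUnion_le (μ := μ) fun i : { x // x ∉ s } => f i)
      rintro x (⟨h1, h2⟩ | ⟨h1, h2⟩)
      · exact absurd (iUnion₂_subset (fun i _ => subset_iUnion f i) h1) h2
      · obtain ⟨i, hi⟩ := mem_iUnion.1 h1
        refine mem_iUnion.2 ⟨⟨i, fun his => h2 ?_⟩, hi⟩
        exact mem_iUnion₂.2 ⟨i, his, hi⟩ }

theorem dualSignedMeasure_apply {p : ℝ≥0∞} [Fact (1 ≤ p)] (hp : p ≠ ∞)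
    (ℓ : Lp ℝ p μ →L[ℝ] ℝ) {A : Set α} (hA : MeasurableSet A) :
    dualSignedMeasure hp ℓ A = ℓ (indicatorConstLp p hA (measure_ne_top μ A) 1) :=
  dif_pos hA

/-- Radon-Nikodym: the indicator of a null set is zero in `L^p`, so the signed measure defined by
`ℓ` is absolutely continuous. -/
theorem exists_integrable_density {p : ℝ≥0∞} [Fact (1 ≤ p)] (hp : p ≠ ∞)
    (ℓ : Lp ℝ p μ →L[ℝ] ℝ) :
    ∃ g : α → ℝ, Measurable g ∧ Integrable g μ ∧ ∀ (A : Set α) (hA : MeasurableSet A),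
      ℓ (indicatorConstLp p hA (measure_ne_top μ A) 1) = ∫ x in A, g x ∂μ := by
  set s := dualSignedMeasure hp ℓ with hs
  have hac : s ≪ᵥ μ.toENNRealVectorMeasure := by
    refine VectorMeasure.AbsolutelyContinuous.mk fun A hA h0 => ?_
    rw [Measure.toENNRealVectorMeasure_apply_measurable hA] at h0
    rw [hs, dualSignedMeasure_apply hp ℓ hA]
    convert map_zero ℓ
    rw [← norm_eq_zero, norm_indicatorConstLp (zero_lt_one.trans_le Fact.out).ne' hp,
      measureReal_def, h0]
    have : 0 < p.toReal := ENNReal.toReal_pos (zero_lt_one.trans_le Fact.out).ne' hp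
    simp [this.ne']
  refine ⟨s.rnDeriv μ, s.measurable_rnDeriv μ, s.integrable_rnDeriv μ, fun A hA => ?_⟩
  rw [← dualSignedMeasure_apply hp ℓ hA, ← withDensityᵥ_apply (s.integrable_rnDeriv μ) hA,
    SignedMeasure.withDensityᵥ_rnDeriv_eq s μ hac]

theorem Lp_clm_ext {p : ℝ≥0∞} [Fact (1 ≤ p)] (hp : p ≠ ∞) {φ ψ : Lp ℝ p μ →L[ℝ] ℝ}
    (h : ∀ (A : Set α) (hA : MeasurableSet A),
      φ (indicatorConstLp p hA (measure_ne_top μ A) 1) =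
        ψ (indicatorConstLp p hA (measure_ne_top μ A) 1)) : φ = ψ := by
  ext f
  refine Lp.induction hp (fun f => φ f = ψ f) ?_ ?_ ?_ f
  · intro c A hA hμ
    rw [Lp.simpleFunc.coe_indicatorConst]
    have : indicatorConstLp p hA hμ.ne c = c • indicatorConstLp p hA hμ.ne (1 : ℝ) := by
      rw [indicatorConstLp, indicatorConstLp, ← MemLp.toLp_const_smul]
      congr 1
      ext x
      by_cases h : x ∈ A <;> simp [h]
    rw [this, map_smul, map_smul, h]
  · intro f g hf hg _ h1 h2
    rw [map_add, map_add, h1, h2]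
  · exact isClosed_eq φ.continuous ψ.continuous

/-- The pairing `(g, f) ↦ ∫ g f` between conjugate real Lebesgue spaces. -/
noncomputable def lpDuality (μ : Measure α) (p q : ℝ≥0∞) [Fact (1 ≤ p)] [Fact (1 ≤ q)]
    [ENNReal.HolderConjugate p q] : Lp ℝ p μ →L[ℝ] Lp ℝ q μ →L[ℝ] ℝ :=
  ContinuousLinearMap.lpPairing μ p q (ContinuousLinearMap.mul ℝ ℝ)

omit [IsFiniteMeasure μ] in
theorem lpDuality_apply {p q : ℝ≥0∞} [Fact (1 ≤ p)] [Fact (1 ≤ q)]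
    [ENNReal.HolderConjugate p q] (f : Lp ℝ p μ) (g : Lp ℝ q μ) :
    lpDuality μ p q f g = ∫ x, f x * g x ∂μ :=
  ContinuousLinearMap.lpPairing_eq_integral _ f g

theorem lpDuality_indicator {p q : ℝ≥0∞} [Fact (1 ≤ p)] [Fact (1 ≤ q)]
    [ENNReal.HolderConjugate p q] (f : Lp ℝ p μ) {A : Set α} (hA : MeasurableSet A) :
    lpDuality μ p q f (indicatorConstLp q hA (measure_ne_top μ A) 1) = ∫ x in A, f x ∂μ := by
  rw [lpDuality_apply, ← integral_indicator hA]
  refine integral_congr_ae ?_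
  filter_upwards [indicatorConstLp_coeFn (p := q) (hs := hA) (hμs := measure_ne_top μ A)
    (c := (1 : ℝ))] with x hx
  rw [hx]
  by_cases h : x ∈ A <;> simp [h]

/-- Multiplication by the indicator function of `A` on `L^p`. -/
noncomputable def lpRestrict {p : ℝ≥0∞} [Fact (1 ≤ p)] {A : Set α} (hA : MeasurableSet A) :
    Lp ℝ p μ →L[ℝ] Lp ℝ p μ :=
  (ContinuousLinearMap.mul ℝ ℝ).holderL μ ∞ p p (indicatorConstLp ∞ hA (measure_ne_top μ A) 1)

theorem lpRestrict_ae {p : ℝ≥0∞} [Fact (1 ≤ p)] {A : Set α} (hA : MeasurableSet A)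
    (f : Lp ℝ p μ) : lpRestrict hA f =ᵐ[μ] A.indicator f := by
  have h1 := (ContinuousLinearMap.mul ℝ ℝ).coeFn_holder (r := p)
    (indicatorConstLp ∞ hA (measure_ne_top μ A) (1 : ℝ)) f
  filter_upwards [h1, indicatorConstLp_coeFn (p := ∞) (hs := hA) (hμs := measure_ne_top μ A)
    (c := (1 : ℝ))] with x hx hx2
  change ((ContinuousLinearMap.mul ℝ ℝ).holder p
    (indicatorConstLp ∞ hA (measure_ne_top μ A) (1 : ℝ)) f) x = _
  rw [hx, hx2]
  by_cases h : x ∈ A <;> simp [h]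

theorem lpRestrict_indicator {p : ℝ≥0∞} [Fact (1 ≤ p)] {A B : Set α} (hA : MeasurableSet A)
    (hB : MeasurableSet B) :
    lpRestrict hA (indicatorConstLp p hB (measure_ne_top μ B) (1 : ℝ)) =
      indicatorConstLp p (hA.inter hB) (measure_ne_top μ _) 1 := by
  refine Lp.ext ?_
  filter_upwards [lpRestrict_ae hA (indicatorConstLp p hB (measure_ne_top μ B) (1 : ℝ)),
    indicatorConstLp_coeFn (p := p) (hs := hB) (hμs := measure_ne_top μ B) (c := (1 : ℝ)),
    indicatorConstLp_coeFn (p := p) (hs := hA.inter hB) (hμs := measure_ne_top μ _)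
      (c := (1 : ℝ))] with x h1 h2 h3
  rw [h1, h3, ← indicator_indicator]
  by_cases h : x ∈ A <;> simp [h, h2]

theorem measurable_coe_sign : Measurable fun x : ℝ => ((SignType.sign x : SignType) : ℝ) := by
  have : (fun x : ℝ => ((SignType.sign x : SignType) : ℝ)) =
      fun x => if 0 < x then 1 else if x < 0 then -1 else 0 := by
    ext x
    rw [sign_apply]
    split_ifs <;> simp
  rw [this]
  exact Measurable.ite measurableSet_Ioi measurable_const
    (Measurable.ite measurableSet_Iio measurable_const measurable_const)

/-- Truncating to `A = {‖g‖ ≤ n}` makes everything bounded. Testing `ℓ` with `sign g * ‖g‖ ^ (Q -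
1)` on `A` gives `I ≤ ‖ℓ‖ * I ^ (1 / P)` for `I = ∫_A ‖g‖ ^ Q`, hence a bound that does not depend
on `n`. -/
theorem lintegral_rpow_restrict_le {p q : ℝ≥0∞} [Fact (1 ≤ p)] [Fact (1 ≤ q)]
    [hpq : ENNReal.HolderConjugate p q] (hp : p ≠ ∞) (hq : q ≠ ∞) (ℓ : Lp ℝ p μ →L[ℝ] ℝ)
    {g : α → ℝ} (hg : Measurable g)
    (hℓ : ∀ (A : Set α) (hA : MeasurableSet A),
      ℓ (indicatorConstLp p hA (measure_ne_top μ A) 1) = ∫ x in A, g x ∂μ) (n : ℕ) :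
    ∫⁻ x in {x | ‖g x‖ ≤ n}, ‖g x‖ₑ ^ q.toReal ∂μ ≤ ENNReal.ofReal (‖ℓ‖ ^ q.toReal) := by
  have hPQ := ENNReal.HolderConjugate.toReal_of_ne_top (p := p) (q := q) hp hq
  set P := p.toReal
  set Q := q.toReal
  set A : Set α := {x | ‖g x‖ ≤ n} with hAdef
  have hA : MeasurableSet A := measurableSet_le hg.norm measurable_const
  have hgA : MemLp (A.indicator g) q μ := by
    refine MemLp.of_bound (hg.indicator hA).aestronglyMeasurable n (ae_of_all _ fun x => ?_)
    by_cases h : x ∈ A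
    · rw [indicator_of_mem h]; exact h
    · simp [h]
  -- After restriction to `A`, `ℓ` is the pairing with a bounded function; both sides agree on
  -- indicators, which determine a continuous functional.
  have key : ℓ.comp (lpRestrict hA) = (lpDuality μ q p) hgA.toLp := by
    refine Lp_clm_ext hp fun B hB => ?_
    rw [lpDuality_indicator, ContinuousLinearMap.comp_apply, lpRestrict_indicator hA hB, hℓ,
      setIntegral_congr_ae hB (g := A.indicator g)
        (hgA.coeFn_toLp.mono fun x hx _ => hx), integral_indicator hA, Measure.restrict_restrict hA]
  let h : α → ℝ := A.indicator fun x => SignType.sign (g x) * ‖g x‖ ^ (Q - 1)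
  have hQ1 : 0 < Q - 1 := sub_pos.2 hPQ.symm.lt
  have hmeas : Measurable h := by
    refine Measurable.indicator (Measurable.mul ?_ ?_) hA
    · exact measurable_coe_sign.comp hg
    · exact hg.norm.pow_const _
  have hnorm : ∀ x, ‖h x‖ = A.indicator (fun x => ‖g x‖ ^ (Q - 1)) x := by
    intro x
    by_cases hx : x ∈ A
    · simp only [h, indicator_of_mem hx, norm_mul]
      rcases lt_trichotomy (g x) 0 with h0 | h0 | h0
      · simp [sign_neg h0, abs_of_nonneg (Real.rpow_nonneg (abs_nonneg (g x)) _)]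
      · simp [h0, Real.zero_rpow hQ1.ne']
      · simp [sign_pos h0, abs_of_nonneg (Real.rpow_nonneg (abs_nonneg (g x)) _)]
    · simp [h, hx]
  have hmem : MemLp h p μ := by
    refine MemLp.of_bound hmeas.aestronglyMeasurable ((n : ℝ) ^ (Q - 1))
      (ae_of_all _ fun x => ?_)
    rw [hnorm]
    by_cases hx : x ∈ A
    · simp only [indicator_of_mem hx]
      exact Real.rpow_le_rpow (norm_nonneg _) hx hQ1.le
    · simp only [indicator_of_notMem hx]; positivity
  have hprod : ∀ x, A.indicator g x * h x = A.indicator (fun x => ‖g x‖ ^ Q) x := by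
    intro x
    by_cases hx : x ∈ A
    · simp only [h, indicator_of_mem hx]
      rw [← mul_assoc, mul_comm (g x), sign_mul_self, ← Real.norm_eq_abs]
      rcases eq_or_ne (g x) 0 with h0 | h0
      · simp [h0, Real.zero_rpow hPQ.symm.pos.ne']
      · have : 0 < ‖g x‖ := norm_pos_iff.2 h0
        nth_rw 1 [← Real.rpow_one ‖g x‖]
        rw [← Real.rpow_add this]; ring_nf
    · simp [hx]
  have hpow : ∀ x, ‖h x‖ ^ P = A.indicator (fun x => ‖g x‖ ^ Q) x := by
    intro x
    rw [hnorm]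
    by_cases hx : x ∈ A
    · simp only [indicator_of_mem hx]
      rw [← Real.rpow_mul (norm_nonneg _), hPQ.symm.sub_one_mul_conj]
    · simp [hx, Real.zero_rpow hPQ.pos.ne']
  set I : ℝ := ∫ x, A.indicator (fun x => ‖g x‖ ^ Q) x ∂μ with hI
  have hI0 : 0 ≤ I := integral_nonneg fun x =>
    indicator_nonneg (fun x _ => Real.rpow_nonneg (norm_nonneg _) _) x
  have hv : ℓ (lpRestrict hA hmem.toLp) = I := by
    rw [← ContinuousLinearMap.comp_apply, key, lpDuality_apply]
    refine integral_congr_ae ?_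
    filter_upwards [hgA.coeFn_toLp, hmem.coeFn_toLp] with x h1 h2
    rw [h1, h2, hprod]
  have hfix : lpRestrict hA hmem.toLp = hmem.toLp := by
    refine Lp.ext ?_
    filter_upwards [lpRestrict_ae hA hmem.toLp, hmem.coeFn_toLp] with x h1 h2
    rw [h1]
    by_cases hx : x ∈ A
    · simp [hx]
    · rw [h2]; simp [hx, h]
  have hn : ‖hmem.toLp‖ = I ^ (1 / P) := by
    rw [Lp.norm_toLp, hmem.eLpNorm_eq_integral_rpow_norm (zero_lt_one.trans_le Fact.out).ne' hp,
      ENNReal.toReal_ofReal (by positivity), one_div]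
    simp_rw [show p.toReal = P from rfl, hpow]
    rfl
  have hle : I ≤ ‖ℓ‖ * I ^ (1 / P) := by
    rw [← hn]
    nth_rw 1 [← hv]
    rw [hfix]
    exact (le_abs_self _).trans (ℓ.le_opNorm _)
  have hfin : I ≤ ‖ℓ‖ ^ Q := by
    rcases hI0.eq_or_lt with h0 | h0
    · rw [← h0]; positivity
    · have h1 : I ^ (1 / Q) ≤ ‖ℓ‖ := by
        have h2 : I ^ (1 / Q) * I ^ (1 / P) = I := by
          rw [← Real.rpow_add h0, one_div, one_div, add_comm, hPQ.inv_add_inv_eq_one,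
            Real.rpow_one]
        refine le_of_mul_le_mul_right (h2.trans_le hle) (by positivity)
      calc I = (I ^ (1 / Q)) ^ Q := by
            rw [← Real.rpow_mul hI0, one_div_mul_cancel hPQ.symm.pos.ne', Real.rpow_one]
        _ ≤ _ := Real.rpow_le_rpow (by positivity) h1 hPQ.symm.pos.le
  calc ∫⁻ x in A, ‖g x‖ₑ ^ Q ∂μ = ENNReal.ofReal I := by
        rw [hI, ofReal_integral_eq_lintegral_ofReal, ← lintegral_indicator hA]
        · refine lintegral_congr fun x => ?_
          by_cases hx : x ∈ A
          · simp only [indicator_of_mem hx]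
            rw [← ofReal_norm, ENNReal.ofReal_rpow_of_nonneg (norm_nonneg _)
              hPQ.symm.pos.le]
          · simp [hx]
        · have := hmem.integrable_norm_rpow (zero_lt_one.trans_le Fact.out).ne' hp
          refine this.congr (ae_of_all _ fun x => hpow x)
        · exact ae_of_all _ fun x =>
            indicator_nonneg (fun x _ => Real.rpow_nonneg (norm_nonneg _) _) x
    _ ≤ _ := ENNReal.ofReal_le_ofReal hfin

/-- Every continuous linear functional on `L^p`, `1 < p < ∞`, is given by a function in `L^q`. -/
theorem exists_lpDuality_eq {p q : ℝ≥0∞} [Fact (1 ≤ p)] [Fact (1 ≤ q)]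
    [hpq : ENNReal.HolderConjugate p q] (hp : p ≠ ∞) (hq : q ≠ ∞) (ℓ : Lp ℝ p μ →L[ℝ] ℝ) :
    ∃ g : Lp ℝ q μ, lpDuality μ q p g = ℓ := by
  obtain ⟨g, hg, -, hℓ⟩ := exists_integrable_density hp ℓ
  have hq0 : q ≠ 0 := (zero_lt_one.trans_le Fact.out).ne'
  have hmem : MemLp g q μ := by
    refine ⟨hg.aestronglyMeasurable, ?_⟩
    rw [eLpNorm_lt_top_iff_lintegral_rpow_enorm_lt_top hq0 hq]
    have hU : (⋃ n : ℕ, {x | ‖g x‖ ≤ n}) = univ := by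
      ext x; simpa using exists_nat_ge |g x|
    have hdir : Directed (· ⊆ ·) fun n : ℕ => {x | ‖g x‖ ≤ n} :=
      directed_of_isDirected_le fun m n hmn x hx => by
        have h : ‖g x‖ ≤ m := hx
        exact h.trans (by exact_mod_cast hmn)
    rw [← setLIntegral_univ, ← hU, setLIntegral_iUnion_of_directed _ hdir]
    exact (iSup_le fun n => lintegral_rpow_restrict_le hp hq ℓ hg hℓ n).trans_lt
      ENNReal.ofReal_lt_top
  refine ⟨hmem.toLp, Lp_clm_ext hp fun A hA => ?_⟩
  rw [lpDuality_indicator, hℓ]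
  exact setIntegral_congr_ae hA (hmem.coeFn_toLp.mono fun x hx _ => hx)

end LpDual

/-! ### Mollification of functions of bounded directional variation. -/

section Mollification

open scoped Convolution Pointwise

variable {E : Type*} [NormedAddCommGroup E] [InnerProductSpace ℝ E] [FiniteDimensional ℝ E]
  [MeasurableSpace E] [BorelSpace E] (μ : Measure E) [μ.IsAddHaarMeasure]

/-- The total variation of `u` over `U` in every single direction is at most one. -/
def DirVarLE (U : Set E) (u : E → ℝ) : Prop :=
  ∀ e : E, ‖e‖ ≤ 1 → ∀ g : E → ℝ, ContDiff ℝ 1 g → HasCompactSupport g → tsupport g ⊆ U →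
    (∀ x, |g x| ≤ 1) → ∫ x, u x * fderiv ℝ g x e ∂μ ≤ 1

/-- The mollification of `u` with the normalized bump function `φ`. -/
noncomputable def mollify (φ : ContDiffBump (0 : E)) (u : E → ℝ) : E → ℝ :=
  (φ.normed μ) ⋆[ContinuousLinearMap.lsmul ℝ ℝ, μ] u

variable {μ}

theorem mollify_eq (φ : ContDiffBump (0 : E)) (u : E → ℝ) (x : E) :
    mollify μ φ u x = ∫ y, φ.normed μ (x - y) * u y ∂μ := by
  rw [mollify, convolution_eq_swap]; rfl

theorem contDiff_mollify (φ : ContDiffBump (0 : E)) {u : E → ℝ} (hu : Integrable u μ) {n : ℕ∞} :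
    ContDiff ℝ n (mollify μ φ u) :=
  φ.hasCompactSupport_normed.contDiff_convolution_left _ φ.contDiff_normed
    hu.locallyIntegrable

/-- The kernel is even, so Fubini moves the mollification from `u` to `θ`. The mollified `θ` is
again an admissible test function: it stays bounded by one, and the assumption on closed balls keeps
its support in `U`. -/
theorem integral_mollify_mul_fderiv_le {U : Set E} {u : E → ℝ} (hu : Integrable u μ)
    (hU : DirVarLE μ U u) (φ : ContDiffBump (0 : E)) {e : E} (he : ‖e‖ ≤ 1)
    {θ : E → ℝ} (hθ : ContDiff ℝ 1 θ) (hθc : HasCompactSupport θ)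
    (hθU : ∀ x ∈ tsupport θ, Metric.closedBall x φ.rOut ⊆ U) (hθ1 : ∀ x, |θ x| ≤ 1) :
    ∫ x, mollify μ φ u x * fderiv ℝ θ x e ∂μ ≤ 1 := by
  have hk : Continuous (φ.normed μ) := φ.continuous_normed
  have hki : Integrable (φ.normed μ) μ := φ.integrable_normed
  set g : E → ℝ := θ ⋆[ContinuousLinearMap.lsmul ℝ ℝ, μ] (φ.normed μ) with hg
  have hgd : ContDiff ℝ 1 g :=
    hθc.contDiff_convolution_left (n := 1) _ hθ hki.locallyIntegrable
  have hsub : tsupport g ⊆ tsupport θ + Metric.closedBall (0 : E) φ.rOut := by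
    have hcomp : IsCompact (tsupport θ + Metric.closedBall (0 : E) φ.rOut) :=
      hθc.isCompact.add (isCompact_closedBall _ _)
    refine closure_minimal ?_ hcomp.isClosed
    refine (support_convolution_subset _).trans (Set.add_subset_add subset_closure ?_)
    rw [φ.support_normed_eq]
    exact Metric.ball_subset_closedBall
  have hgU : tsupport g ⊆ U := by
    refine hsub.trans ?_
    rintro _ ⟨x, hx, y, hy, rfl⟩
    refine hθU x hx ?_
    simpa using hy
  have hgc : HasCompactSupport g := hθc.convolution _ φ.hasCompactSupport_normed
  have hg1 : ∀ x, |g x| ≤ 1 := by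
    intro x
    rw [hg, convolution_def, ← Real.norm_eq_abs]
    have h1 : ∫ t, φ.normed μ (x - t) ∂μ = 1 := by
      rw [integral_sub_left_eq_self (φ.normed μ) μ x, φ.integral_normed]
    rw [← h1]
    refine norm_integral_le_of_norm_le (hki.comp_sub_left x) (ae_of_all _ fun t => ?_)
    rw [ContinuousLinearMap.lsmul_apply, norm_smul, Real.norm_eq_abs, Real.norm_eq_abs,
      abs_of_nonneg (φ.nonneg_normed _)]
    exact mul_le_of_le_one_left (φ.nonneg_normed _) (hθ1 t)
  have hfd : Continuous fun x => fderiv ℝ θ x e :=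
    (hθ.continuous_fderiv one_ne_zero).clm_apply continuous_const
  have hfc : HasCompactSupport fun x => fderiv ℝ θ x e :=
    (hθc.fderiv (𝕜 := ℝ)).mono (fun x hx h0 => hx (by simp [h0]))
  have hfi : Integrable (fun x => fderiv ℝ θ x e) μ := hfd.integrable_of_hasCompactSupport hfc
  have hder : ∀ x, fderiv ℝ g x e = ∫ t, fderiv ℝ θ t e * φ.normed μ (x - t) ∂μ := by
    intro x
    rw [(hθc.hasFDerivAt_convolution_left (ContinuousLinearMap.lsmul ℝ ℝ) hθ
      hki.locallyIntegrable x).fderiv, convolution_def]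
    have hI : Integrable (fun t => ContinuousLinearMap.precompL E
        (ContinuousLinearMap.lsmul ℝ ℝ) (fderiv ℝ θ t) (φ.normed μ (x - t))) μ :=
      (hθc.fderiv (𝕜 := ℝ)).convolutionExists_left _
        (hθ.continuous_fderiv one_ne_zero) hki.locallyIntegrable x
    exact ContinuousLinearMap.integral_apply hI e
  have hswap : ∫ x, mollify μ φ u x * fderiv ℝ θ x e ∂μ = ∫ x, u x * fderiv ℝ g x e ∂μ := by
    simp_rw [mollify_eq, hder, ← integral_mul_const, ← integral_const_mul]
    have hint : Integrable (fun z : E × E => φ.normed μ (z.1 - z.2) *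
        (fderiv ℝ θ z.1 e * u z.2)) (μ.prod μ) := by
      obtain ⟨C, hC⟩ := hk.bounded_above_of_compact_support φ.hasCompactSupport_normed
      exact (hfi.mul_prod hu).bdd_mul (c := C)
        (hk.comp (continuous_fst.sub continuous_snd)).aestronglyMeasurable
        (ae_of_all _ fun z => hC _)
    rw [integral_integral_swap]
    · refine integral_congr_ae (ae_of_all _ fun x => integral_congr_ae (ae_of_all _ fun y => ?_))
      simp only
      rw [← φ.normed_neg, neg_sub]; ring
    · refine hint.congr (ae_of_all _ fun z => ?_)
      simp only [Function.uncurry]; ring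
  rw [hswap]
  exact hU e he g hgd hgc hgU hg1

/-- Integration by parts, with its sign absorbed by testing with `-θ`. -/
theorem integral_fderiv_mollify_mul_le {U : Set E} {u : E → ℝ} (hu : Integrable u μ)
    (hU : DirVarLE μ U u) (φ : ContDiffBump (0 : E)) {e : E} (he : ‖e‖ ≤ 1)
    {θ : E → ℝ} (hθ : ContDiff ℝ 1 θ) (hθc : HasCompactSupport θ)
    (hθU : ∀ x ∈ tsupport θ, Metric.closedBall x φ.rOut ⊆ U) (hθ1 : ∀ x, |θ x| ≤ 1) :
    ∫ x, fderiv ℝ (mollify μ φ u) x e * θ x ∂μ ≤ 1 := by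
  have hw : ContDiff ℝ 1 (mollify μ φ u) := contDiff_mollify (n := 1) φ hu
  have h := integral_mollify_mul_fderiv_le hu hU φ he (θ := fun x => -θ x) hθ.neg
    (by simpa [HasCompactSupport, tsupport_neg] using hθc.neg)
    (by
      have : tsupport (fun x => -θ x) = tsupport θ := by
        simp [tsupport, Function.support_fun_neg]
      rwa [this]) (by simpa using hθ1)
  have hfd : Continuous fun x => fderiv ℝ θ x e :=
    (hθ.continuous_fderiv one_ne_zero).clm_apply continuous_const
  have hfc : HasCompactSupport fun x => fderiv ℝ θ x e :=
    (hθc.fderiv (𝕜 := ℝ)).mono (fun x hx h0 => hx (by simp [h0]))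
  have hwd : Continuous fun x => fderiv ℝ (mollify μ φ u) x e :=
    (hw.continuous_fderiv one_ne_zero).clm_apply continuous_const
  have hparts := integral_mul_fderiv_eq_neg_fderiv_mul_of_integrable (μ := μ)
    (f := mollify μ φ u) (g := θ) (v := e)
    ((hwd.mul hθ.continuous).integrable_of_hasCompactSupport hθc.mul_left)
    ((hw.continuous.mul hfd).integrable_of_hasCompactSupport hfc.mul_left)
    ((hw.continuous.mul hθ.continuous).integrable_of_hasCompactSupport hθc.mul_left)
    (fun x _ => (hw.differentiable one_ne_zero) x) (fun x _ => (hθ.differentiable one_ne_zero) x)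
  have hneg : ∀ x, fderiv ℝ (fun x => -θ x) x e = -fderiv ℝ θ x e := by
    intro x
    rw [fderiv_fun_neg]; rfl
  simp_rw [hneg, mul_neg, integral_neg, hparts, neg_neg] at h
  exact h

/-- A smooth approximation of the sign function. -/
noncomputable def softSign (δ t : ℝ) : ℝ := t / √(δ ^ 2 + t ^ 2)

theorem contDiff_softSign {δ : ℝ} (hδ : 0 < δ) : ContDiff ℝ 1 (softSign δ) := by
  unfold softSign
  refine contDiff_id.div (ContDiff.sqrt (by fun_prop) fun t => by positivity) fun t => ?_
  positivity

theorem abs_softSign_le (δ t : ℝ) : |softSign δ t| ≤ 1 := by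
  unfold softSign
  rw [abs_div, abs_of_nonneg (Real.sqrt_nonneg _)]
  refine div_le_one_of_le₀ (Real.abs_le_sqrt (by nlinarith)) (Real.sqrt_nonneg _)

/-- Lets a `C¹` test function replace the sign at the cost of an error `δ`. It follows from `√(δ² +
t²) ≤ |t| + δ` and `(|t| - δ)(|t| + δ) ≤ t²`. -/
theorem abs_sub_le_mul_softSign {δ : ℝ} (hδ : 0 < δ) (t : ℝ) : |t| - δ ≤ t * softSign δ t := by
  unfold softSign
  have hs : 0 < √(δ ^ 2 + t ^ 2) := by positivity
  rw [← mul_div_assoc, le_div_iff₀ hs]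
  have h1 : √(δ ^ 2 + t ^ 2) ≤ |t| + δ := by
    rw [Real.sqrt_le_left (by positivity)]
    nlinarith [sq_abs t, mul_nonneg (abs_nonneg t) hδ.le]
  rcases le_total (|t|) δ with h | h
  · nlinarith [mul_self_nonneg t]
  · nlinarith [mul_le_mul_of_nonneg_left h1 (sub_nonneg.2 h), sq_abs t]

omit [MeasurableSpace E] [BorelSpace E] in
theorem exists_cutoff {K A : Set E} (hK : IsCompact K) (hA : IsOpen A) (hKA : K ⊆ A) :
    ∃ χ : E → ℝ, ContDiff ℝ 1 χ ∧ HasCompactSupport χ ∧ tsupport χ ⊆ A ∧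
      (∀ x, 0 ≤ χ x) ∧ (∀ x, χ x ≤ 1) ∧ ∀ x ∈ K, χ x = 1 := by
  obtain ⟨V, hVo, hKV, hVA, hVc⟩ := exists_open_between_and_isCompact_closure hK hA hKA
  obtain ⟨χ, hχ, hr, hs, h1⟩ := exists_contMDiff_support_eq_eq_one_iff (n := 1)
    (modelWithCornersSelf ℝ E) hVo hK.isClosed hKV
  have ht : tsupport χ = closure V := by rw [tsupport, hs]
  exact ⟨χ, hχ.contDiff, by rwa [HasCompactSupport, ht], ht ▸ hVA, fun x => (hr ⟨x, rfl⟩).1,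
    fun x => (hr ⟨x, rfl⟩).2, fun x hx => (h1 x).1 hx⟩

/-- The directional derivatives of a mollification are controlled by the directional variation. -/
theorem lintegral_fderiv_mollify_le {U : Set E} {u : E → ℝ} (hu : Integrable u μ)
    (hU : DirVarLE μ U u) (φ : ContDiffBump (0 : E)) {e : E} (he : ‖e‖ ≤ 1)
    {A : Set E} (hA : IsOpen A) (hAb : Bornology.IsBounded A)
    (hAU : ∀ x ∈ A, Metric.closedBall x φ.rOut ⊆ U) :
    ∫⁻ x in A, ‖fderiv ℝ (mollify μ φ u) x e‖ₑ ∂μ ≤ 1 := by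
  -- Two derivatives are needed because the test function `χ * softSign δ D` is built from the
  -- derivative `D` itself.
  have hw : ContDiff ℝ 2 (mollify μ φ u) := contDiff_mollify (n := 2) φ hu
  set D : E → ℝ := fun x => fderiv ℝ (mollify μ φ u) x e with hD
  have hDd : ContDiff ℝ 1 D := (hw.fderiv_right (m := 1) (by norm_num)).clm_apply contDiff_const
  have hcompact : ∀ K ⊆ A, IsCompact K → ∫⁻ x in K, ‖D x‖ₑ ∂μ ≤ 1 := by
    intro K hKA hK
    obtain ⟨χ, hχ, hχc, hχA, hχ0, hχ1, hχK⟩ := exists_cutoff hK hA hKA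
    have hbase : ∀ δ > 0, ∫ x in K, |D x| ∂μ ≤ 1 + δ * ∫ x, χ x ∂μ := by
      intro δ hδ
      have hθd : ContDiff ℝ 1 fun x => χ x * softSign δ (D x) :=
        hχ.mul ((contDiff_softSign hδ).comp hDd)
      have hsup : tsupport (fun x => χ x * softSign δ (D x)) ⊆ tsupport χ :=
        closure_mono fun x hx h0 => hx (by simp [h0])
      have h := integral_fderiv_mollify_mul_le hu hU φ he hθd hχc.mul_right
        (fun x hx => hAU x (hχA (hsup hx))) (fun x => by
          rw [abs_mul, abs_of_nonneg (hχ0 x)]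
          exact mul_le_one₀ (hχ1 x) (abs_nonneg _) (abs_softSign_le δ _))
      have hi1 : Integrable (fun x => χ x * |D x|) μ :=
        (hχ.continuous.mul hDd.continuous.abs).integrable_of_hasCompactSupport hχc.mul_right
      have hi2 : Integrable (fun x => D x * (χ x * softSign δ (D x))) μ :=
        (hDd.continuous.mul hθd.continuous).integrable_of_hasCompactSupport
          (hχc.mul_right.mul_left)
      have hi3 : Integrable χ μ := hχ.continuous.integrable_of_hasCompactSupport hχc
      calc ∫ x in K, |D x| ∂μ = ∫ x in K, χ x * |D x| ∂μ :=
            setIntegral_congr_fun hK.measurableSet fun x hx => by simp [hχK x hx]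
        _ ≤ ∫ x, χ x * |D x| ∂μ := setIntegral_le_integral hi1
            (ae_of_all _ fun x => mul_nonneg (hχ0 x) (abs_nonneg _))
        _ ≤ ∫ x, (D x * (χ x * softSign δ (D x)) + δ * χ x) ∂μ := by
            refine integral_mono hi1 (hi2.add (hi3.const_mul δ)) fun x => ?_
            have := mul_le_mul_of_nonneg_left (abs_sub_le_mul_softSign hδ (D x)) (hχ0 x)
            simp only
            linarith
        _ ≤ _ := by
            rw [integral_add hi2 (hi3.const_mul δ), integral_const_mul]
            linarith
    have hlim : ∫ x in K, |D x| ∂μ ≤ 1 := by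
      have ht : Tendsto (fun δ : ℝ => 1 + δ * ∫ x, χ x ∂μ) (𝓝[>] 0) (𝓝 (1 + 0 * ∫ x, χ x ∂μ)) :=
        (tendsto_const_nhds.add (tendsto_id.mul_const _)).mono_left nhdsWithin_le_nhds
      rw [zero_mul, add_zero] at ht
      exact ge_of_tendsto ht (eventually_mem_nhdsWithin.mono hbase)
    have hDi : IntegrableOn D K μ := hDd.continuous.continuousOn.integrableOn_compact hK
    rw [← ofReal_integral_norm_eq_lintegral_enorm hDi]
    exact ENNReal.ofReal_le_one.2 hlim
  obtain ⟨F, hFc, hFA, hFU, hFm⟩ := hA.exists_iUnion_isClosed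
  rw [← hFU, setLIntegral_iUnion_of_directed _ hFm.directed_le]
  exact iSup_le fun n => hcompact _ (hFA n)
    (Metric.isCompact_of_isClosed_isBounded (hFc n) (hAb.subset (hFA n)))

end Mollification

/-! ### `L¹` estimates for translates. -/

section Translation

variable {E : Type*} [NormedAddCommGroup E] [InnerProductSpace ℝ E] [FiniteDimensional ℝ E]
  [MeasurableSpace E] [BorelSpace E] {μ : Measure E} [μ.IsAddHaarMeasure]

theorem lintegral_fderiv_mollify_le_enorm {U : Set E} {u : E → ℝ} (hu : Integrable u μ)
    (hU : DirVarLE μ U u) (φ : ContDiffBump (0 : E)) (e : E)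
    {A : Set E} (hA : IsOpen A) (hAb : Bornology.IsBounded A)
    (hAU : ∀ x ∈ A, Metric.closedBall x φ.rOut ⊆ U) :
    ∫⁻ x in A, ‖fderiv ℝ (mollify μ φ u) x e‖ₑ ∂μ ≤ ‖e‖ₑ := by
  rcases eq_or_ne e 0 with rfl | he
  · simp
  have hn : ‖e‖ ≠ 0 := norm_ne_zero_iff.2 he
  have h := lintegral_fderiv_mollify_le hu hU φ (e := (‖e‖⁻¹) • e)
    (by rw [norm_smul, norm_inv, norm_norm, inv_mul_cancel₀ hn]) hA hAb hAU
  have heq : ∀ x, ‖fderiv ℝ (mollify μ φ u) x e‖ₑ =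
      ‖e‖ₑ * ‖fderiv ℝ (mollify μ φ u) x (‖e‖⁻¹ • e)‖ₑ := by
    intro x
    rw [← enorm_norm e, ← enorm_mul, ← smul_eq_mul, ← map_smul, smul_smul,
      mul_inv_cancel₀ hn, one_smul]
  simp_rw [heq]
  rw [lintegral_const_mul' _ _ enorm_ne_top]
  exact mul_le_of_le_one_right' h

/-- The bump function at the origin with radii `r / 2` and `r`. -/
noncomputable def halfBump (r : ℝ) (hr : 0 < r) : ContDiffBump (0 : E) :=
  ⟨r / 2, r, by positivity, by linarith⟩

/-- Lebesgue differentiation along balls that need not be centred at `x`, provided the displacement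
of the centre is at most a fixed multiple of the radius. The displacement `c n` later pushes points
from the boundary into the domain. -/
theorem ae_tendsto_mollify_add {u : E → ℝ} (hu : Integrable u μ) {r : ℕ → ℝ}
    (hr : ∀ n, 0 < r n) (hr0 : Tendsto r atTop (𝓝 0)) {c : ℕ → E} {K : ℝ}
    (hc : ∀ n, ‖c n‖ ≤ K * r n) :
    ∀ᵐ x ∂μ, Tendsto (fun n => mollify μ (halfBump (r n) (hr n)) u (x + c n)) atTop
      (𝓝 (u x)) := by
  filter_upwards [IsUnifLocDoublingMeasure.ae_tendsto_average_norm_sub μ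
    hu.locallyIntegrable K] with x hx
  have h := hx (fun n => x + c n) r (l := atTop)
    (tendsto_nhdsWithin_iff.2 ⟨hr0, Eventually.of_forall hr⟩)
    (Eventually.of_forall fun n => by simpa [dist_eq_norm] using hc n)
  -- The outer radius of `halfBump` is twice the inner one, so its normalized kernel is at most `2 ^
  -- dim` divided by the volume of the outer ball.
  set C : ℝ := 2 ^ Module.finrank ℝ E
  have h2 := h.const_mul C
  rw [mul_zero] at h2
  rw [tendsto_iff_norm_sub_tendsto_zero]
  refine squeeze_zero (fun n => norm_nonneg _) (fun n => ?_) h2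
  set φ : ContDiffBump (0 : E) := halfBump (r n) (hr n)
  set z := x + c n
  have hφr : φ.rOut = r n := rfl
  have hk : ∀ y, φ.normed μ y ≤ C / μ.real (Metric.closedBall 0 (r n)) :=
    fun y => φ.normed_le_div_measure_closedBall_rOut μ 2
      (by simp only [φ, halfBump]; linarith) y
  have hki : Integrable (φ.normed μ) μ := φ.integrable_normed
  have h1 : ∫ y, φ.normed μ (z - y) ∂μ = 1 := by
    rw [integral_sub_left_eq_self (φ.normed μ) μ z, φ.integral_normed]
  have hi1 : Integrable (fun y => φ.normed μ (z - y) * u y) μ :=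
    hu.bdd_mul (c := C / μ.real (Metric.closedBall 0 (r n)))
      (φ.continuous_normed.comp (continuous_const.sub continuous_id)).aestronglyMeasurable
      (ae_of_all _ fun y => by
        rw [Real.norm_eq_abs, abs_of_nonneg (φ.nonneg_normed _)]; exact hk _)
  have hi2 : Integrable (fun y => φ.normed μ (z - y) * u x) μ := (hki.comp_sub_left z).mul_const _
  have hd : mollify μ φ u z - u x = ∫ y, φ.normed μ (z - y) * (u y - u x) ∂μ := by
    simp_rw [mul_sub]
    rw [integral_sub hi1 hi2, ← mollify_eq, integral_mul_const, h1, one_mul]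
  have hsupp : ∀ y ∉ Metric.closedBall z (r n), φ.normed μ (z - y) = 0 := by
    intro y hy
    rw [← Function.notMem_support, φ.support_normed_eq, Metric.mem_ball, dist_zero_right, hφr,
      not_lt, ← dist_eq_norm, dist_comm]
    exact (not_le.1 hy).le
  rw [hd, setAverage_eq, smul_eq_mul, ← integral_const_mul, ← integral_const_mul]
  have hb : ∀ y, ‖φ.normed μ (z - y) * (u y - u x)‖ ≤ (Metric.closedBall z (r n)).indicator
      (fun y => C * ((μ.real (Metric.closedBall z (r n)))⁻¹ * ‖u y - u x‖)) y := by
    intro y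
    by_cases hy : y ∈ Metric.closedBall z (r n)
    · rw [indicator_of_mem hy, norm_mul, Real.norm_eq_abs, abs_of_nonneg (φ.nonneg_normed _),
        ← mul_assoc, ← div_eq_mul_inv, measureReal_def, Measure.addHaar_closedBall_center μ z,
        ← measureReal_def]
      exact mul_le_mul_of_nonneg_right (hk _) (norm_nonneg _)
    · rw [indicator_of_notMem hy, hsupp y hy]; simp
  refine (norm_integral_le_of_norm_le ?_ (ae_of_all _ hb)).trans_eq
    (integral_indicator measurableSet_closedBall)
  rw [integrable_indicator_iff measurableSet_closedBall]
  refine Integrable.const_mul (Integrable.const_mul (Integrable.norm ?_) _) _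
  exact hu.integrableOn.sub (integrableOn_const measure_closedBall_lt_top.ne)

omit [InnerProductSpace ℝ E] [FiniteDimensional ℝ E] in
theorem setLIntegral_comp_add_right {A : Set E} {f : E → ℝ≥0∞} (c : E) :
    ∫⁻ x in A, f (x + c) ∂μ = ∫⁻ y in (fun y => y - c) ⁻¹' A, f y ∂μ := by
  have h := (measurePreserving_add_right μ c).setLIntegral_comp_emb
    (measurableEmbedding_addRight c) f A
  rw [image_add_right] at h
  simpa [sub_eq_add_neg] using h

omit [InnerProductSpace ℝ E] [FiniteDimensional ℝ E] [MeasurableSpace E] [BorelSpace E] in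
theorem isBounded_preimage_sub {A : Set E} (hA : Bornology.IsBounded A) (c : E) :
    Bornology.IsBounded ((fun y => y - c) ⁻¹' A) := by
  obtain ⟨M, hM⟩ := hA.exists_norm_le
  refine isBounded_iff_forall_norm_le.2 ⟨M + ‖c‖, fun y hy => ?_⟩
  calc ‖y‖ = ‖(y - c) + c‖ := by rw [sub_add_cancel]
    _ ≤ _ := (norm_add_le _ _).trans (add_le_add_left (hM _ hy) _)

/-- Functions of bounded directional variation, normalized. -/
structure IsUnitVar (μ : Measure E) (U : Set E) (u : E → ℝ) : Prop where
  measurable : Measurable u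
  integrable : Integrable u μ
  dirVarLE : DirVarLE μ U u

/-- The increment is the integral of the derivative along the segment from `x` to `x + h`. After
exchanging integrals, each slice is the `L¹` norm of a directional derivative on a translate of `A`.
-/
theorem lintegral_mollify_add_sub_le {U : Set E} {u : E → ℝ} (hu : IsUnitVar μ U u)
    (φ : ContDiffBump (0 : E)) {A : Set E} (hA : IsOpen A) (hAb : Bornology.IsBounded A) {h : E}
    (hAU : ∀ x ∈ A, ∀ s : ℝ, 0 ≤ s → s ≤ 1 → Metric.closedBall (x + s • h) φ.rOut ⊆ U) :
    ∫⁻ x in A, ‖mollify μ φ u (x + h) - mollify μ φ u x‖ₑ ∂μ ≤ ‖h‖ₑ := by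
  set w := mollify μ φ u
  have hw : ContDiff ℝ 1 w := contDiff_mollify (n := 1) φ hu.integrable
  have hwc : Continuous (fderiv ℝ w) := hw.continuous_fderiv one_ne_zero
  have hbase : ∀ x, ‖w (x + h) - w x‖ₑ ≤ ∫⁻ s in Ioc (0 : ℝ) 1, ‖fderiv ℝ w (x + s • h) h‖ₑ := by
    intro x
    have hder : ∀ s ∈ uIcc (0 : ℝ) 1,
        HasDerivAt (fun s : ℝ => w (x + s • h)) (fderiv ℝ w (x + s • h) h) s := by
      intro s _
      have h1 : HasDerivAt (fun s : ℝ => x + s • h) h s := by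
        simpa using ((hasDerivAt_id s).smul_const h).const_add x
      exact ((hw.differentiable one_ne_zero) (x + s • h)).hasFDerivAt.comp_hasDerivAt s h1
    have hcont : Continuous fun s : ℝ => fderiv ℝ w (x + s • h) h :=
      (hwc.comp (by fun_prop)).clm_apply continuous_const
    have := intervalIntegral.integral_eq_sub_of_hasDerivAt hder (hcont.intervalIntegrable _ _)
    simp only [one_smul, zero_smul, add_zero] at this
    rw [← this, intervalIntegral.integral_of_le zero_le_one]
    exact enorm_integral_le_lintegral_enorm _
  have hm : Measurable fun z : E × ℝ => ‖fderiv ℝ w (z.1 + z.2 • h) h‖ₑ := by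
    have : Continuous fun z : E × ℝ => fderiv ℝ w (z.1 + z.2 • h) h :=
      (hwc.comp (by fun_prop)).clm_apply continuous_const
    exact this.measurable.enorm
  calc ∫⁻ x in A, ‖w (x + h) - w x‖ₑ ∂μ
      ≤ ∫⁻ x in A, (∫⁻ s in Ioc (0 : ℝ) 1, ‖fderiv ℝ w (x + s • h) h‖ₑ) ∂μ :=
        lintegral_mono hbase
    _ = ∫⁻ s in Ioc (0 : ℝ) 1, (∫⁻ x in A, ‖fderiv ℝ w (x + s • h) h‖ₑ ∂μ) :=
        lintegral_lintegral_swap hm.aemeasurable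
    _ ≤ ∫⁻ s in Ioc (0 : ℝ) 1, ‖h‖ₑ := by
        refine setLIntegral_mono measurable_const fun s hs => ?_
        rw [setLIntegral_comp_add_right (f := fun y => ‖fderiv ℝ w y h‖ₑ)]
        refine lintegral_fderiv_mollify_le_enorm hu.integrable hu.dirVarLE φ h
          (hA.preimage (by fun_prop)) ?_ ?_
        · exact isBounded_preimage_sub hAb _
        · intro y hy
          have := hAU _ hy s hs.1.le hs.2
          simpa using this
    _ = ‖h‖ₑ := by simp

/-- `L¹` estimate of the translates of a function of bounded variation. -/
theorem lintegral_add_sub_le {U : Set E} {u : E → ℝ} (hu : IsUnitVar μ U u)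
    {A : Set E} (hA : IsOpen A) (hAb : Bornology.IsBounded A) {h : E} {r : ℝ} (hr : 0 < r)
    (hAU : ∀ x ∈ A, ∀ s : ℝ, 0 ≤ s → s ≤ 1 → Metric.closedBall (x + s • h) r ⊆ U) :
    ∫⁻ x in A, ‖u (x + h) - u x‖ₑ ∂μ ≤ ‖h‖ₑ := by
  set ρ : ℕ → ℝ := fun n => r / (n + 1) with hρ
  have hρpos : ∀ n, 0 < ρ n := fun n => by positivity
  have hρ0 : Tendsto ρ atTop (𝓝 0) := by
    simpa [hρ, Function.comp_def] using
      (tendsto_const_div_atTop_nhds_zero_nat r).comp (tendsto_add_atTop_nat 1)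
  have hρr : ∀ n, ρ n ≤ r := fun n => div_le_self hr.le (by linarith [n.cast_nonneg (α := ℝ)])
  have h1 := ae_tendsto_mollify_add hu.integrable hρpos hρ0 (c := fun _ => 0) (K := 0)
    (by simp)
  simp only [add_zero] at h1
  have h2 := (measurePreserving_add_right μ h).quasiMeasurePreserving.ae h1
  have hae : ∀ᵐ x ∂μ.restrict A, ‖u (x + h) - u x‖ₑ ≤ liminf (fun n =>
      ‖mollify μ (halfBump (ρ n) (hρpos n)) u (x + h) -
        mollify μ (halfBump (ρ n) (hρpos n)) u x‖ₑ) atTop := by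
    filter_upwards [ae_restrict_of_ae h1, ae_restrict_of_ae h2] with x hx1 hx2
    exact ((hx2.sub hx1).enorm).liminf_eq.ge
  -- Fatou carries the estimate from the mollifications to `u`.
  refine (lintegral_mono_ae hae).trans ((lintegral_liminf_le fun n => ?_).trans ?_)
  · have hc : Continuous (mollify μ (halfBump (ρ n) (hρpos n)) u) :=
      (contDiff_mollify (n := 0) _ hu.integrable).continuous
    exact ((hc.comp (continuous_add_const h)).sub hc).measurable.enorm
  · refine liminf_le_of_frequently_le' (Frequently.of_forall fun n => ?_)
    refine lintegral_mollify_add_sub_le hu _ hA hAb fun x hx s hs0 hs1 => ?_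
    exact (Metric.closedBall_subset_closedBall (hρr n)).trans (hAU x hx s hs0 hs1)

end Translation

/-! ### The `L¹` Poincaré inequality by propagation of `L¹` control. -/

section Poincare

variable {E : Type*} [NormedAddCommGroup E] [InnerProductSpace ℝ E] [FiniteDimensional ℝ E]
  [MeasurableSpace E] [BorelSpace E] {μ : Measure E} [μ.IsAddHaarMeasure]

theorem integral_fderiv_eq_zero {g : E → ℝ} (hg : ContDiff ℝ 1 g) (hgc : HasCompactSupport g)
    (e : E) : ∫ x, fderiv ℝ g x e ∂μ = 0 := by
  have hfd : Continuous fun x => fderiv ℝ g x e :=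
    (hg.continuous_fderiv one_ne_zero).clm_apply continuous_const
  have hfc : HasCompactSupport fun x => fderiv ℝ g x e :=
    (hgc.fderiv (𝕜 := ℝ)).mono (fun x hx h0 => hx (by simp [h0]))
  have h := integral_mul_fderiv_eq_neg_fderiv_mul_of_integrable (μ := μ)
    (f := fun _ => (1 : ℝ)) (g := g) (v := e) (by simp)
    (by simpa using hfd.integrable_of_hasCompactSupport hfc)
    (by simpa using hg.continuous.integrable_of_hasCompactSupport hgc)
    (fun x _ => differentiableAt_const _) (fun x _ => (hg.differentiable one_ne_zero) x)
  simpa using h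

/-- The constant is subtracted on `U` only, which preserves integrability on the whole space.
Derivatives of test functions vanish off `U` and have integral zero, so the variation is unaffected.
-/
theorem IsUnitVar.sub_const {U : Set E} (hUo : IsOpen U) (hUb : Bornology.IsBounded U) {u : E → ℝ}
    (hu : IsUnitVar μ U u) (c : ℝ) :
    IsUnitVar μ U fun x => u x - U.indicator (fun _ => c) x := by
  have hci : Integrable (U.indicator fun _ => c) μ :=
    (integrable_indicator_iff hUo.measurableSet).2 (integrableOn_const hUb.measure_lt_top.ne)
  refine ⟨hu.measurable.sub (measurable_const.indicator hUo.measurableSet),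
    hu.integrable.sub hci, fun e he g hg hgc hgU hg1 => ?_⟩
  have hfd : Continuous fun x => fderiv ℝ g x e :=
    (hg.continuous_fderiv one_ne_zero).clm_apply continuous_const
  have hfc : HasCompactSupport fun x => fderiv ℝ g x e :=
    (hgc.fderiv (𝕜 := ℝ)).mono (fun x hx h0 => hx (by simp [h0]))
  obtain ⟨C, hC⟩ := hfd.bounded_above_of_compact_support hfc
  have heq : ∀ x, U.indicator (fun _ => c) x * fderiv ℝ g x e = c * fderiv ℝ g x e := by
    intro x
    by_cases hx : x ∈ U
    · simp [hx]
    · have : fderiv ℝ g x = 0 := by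
        by_contra h0
        exact hx (hgU (support_fderiv_subset ℝ h0))
      simp [this]
  simp_rw [sub_mul]
  rw [integral_sub]
  · simp_rw [heq]
    rw [integral_const_mul, integral_fderiv_eq_zero hg hgc, mul_zero, sub_zero]
    exact hu.dirVarLE e he g hg hgc hgU hg1
  · exact hu.integrable.mul_bdd (c := C) hfd.aestronglyMeasurable (ae_of_all _ hC)
  · exact hci.mul_bdd (c := C) hfd.aestronglyMeasurable (ae_of_all _ hC)

/-- Write `y = h + x` with `‖h‖ < 2r`, exchange the integrals and apply the translation estimate for
each `h`. The segments stay within `3r` of `a`, and the radius `4r` leaves room for mollification at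
scale `r / 2`. -/
theorem lintegral_lintegral_ball_sub_le {U : Set E} {u : E → ℝ} (hu : IsUnitVar μ U u)
    {a : E} {r : ℝ} (hr : 0 < r) (hU : Metric.closedBall a (4 * r) ⊆ U) :
    ∫⁻ x in Metric.ball a r, ∫⁻ y in Metric.ball a r, ‖u y - u x‖ₑ ∂μ ∂μ ≤
      ENNReal.ofReal (2 * r) * μ (Metric.ball 0 (2 * r)) := by
  set D := Metric.ball a r with hD
  set B := Metric.ball (0 : E) (2 * r) with hB
  have hm : Measurable fun z : E × E => ‖u (z.2 + z.1) - u z.1‖ₑ :=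
    ((hu.measurable.comp (measurable_snd.add measurable_fst)).sub
      (hu.measurable.comp measurable_fst)).enorm
  calc ∫⁻ x in D, ∫⁻ y in D, ‖u y - u x‖ₑ ∂μ ∂μ
      ≤ ∫⁻ x in D, ∫⁻ h in B, ‖u (h + x) - u x‖ₑ ∂μ ∂μ := by
        refine setLIntegral_mono' measurableSet_ball fun x hx => ?_
        rw [setLIntegral_comp_add_right (f := fun y => ‖u y - u x‖ₑ)]
        refine lintegral_mono_set fun y hy => ?_
        have h1 : dist y x < 2 * r := by
          have := dist_triangle_right y x a
          rw [hD, Metric.mem_ball] at hx hy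
          linarith
        simpa [hB, ← dist_eq_norm] using h1
    _ = ∫⁻ h in B, ∫⁻ x in D, ‖u (h + x) - u x‖ₑ ∂μ ∂μ :=
        lintegral_lintegral_swap hm.aemeasurable
    _ ≤ ∫⁻ h in B, ENNReal.ofReal (2 * r) ∂μ := by
        refine setLIntegral_mono measurable_const fun h hh => ?_
        have hh' : ‖h‖ < 2 * r := by simpa [hB] using hh
        have h2 : ‖h‖ₑ ≤ ENNReal.ofReal (2 * r) := by
          rw [← ofReal_norm]; exact ENNReal.ofReal_le_ofReal hh'.le
        refine le_trans ?_ h2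
        simp_rw [add_comm h]
        refine lintegral_add_sub_le hu Metric.isOpen_ball Metric.isBounded_ball
          (half_pos hr) fun x hx s hs0 hs1 => ?_
        refine (Metric.closedBall_subset_closedBall' ?_).trans hU
        have h3 : dist (x + s • h) a ≤ dist x a + ‖s • h‖ := by
          rw [dist_eq_norm, dist_eq_norm, add_sub_right_comm]
          exact norm_add_le _ _
        have h4 : ‖s • h‖ ≤ 2 * r := by
          rw [norm_smul, Real.norm_eq_abs, abs_of_nonneg hs0]
          nlinarith [norm_nonneg h]
        rw [Metric.mem_ball] at hx
        linarith
    _ = _ := by rw [setLIntegral_const]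

/-- Interior cone condition near every point of the closure. -/
def UniformCone (U : Set E) : Prop :=
  ∀ x₀ ∈ closure U, ∃ (ν : E) (R κ : ℝ), ‖ν‖ = 1 ∧ 0 < R ∧ 0 < κ ∧ κ ≤ 1 / 2 ∧
    ∀ x ∈ U, dist x x₀ < R → ∀ v, ‖v - ν‖ ≤ κ → ∀ s, 0 ≤ s → s ≤ R → x + s • v ∈ U

/-- The `L¹` norm on `A` is controlled by the one on `B`, uniformly on unit variation functions. -/
def L1Ctrl (μ : Measure E) (U B A : Set E) : Prop :=
  ∃ C : ℝ≥0∞, C ≠ ∞ ∧ ∀ u, IsUnitVar μ U u →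
    ∫⁻ x in A, ‖u x‖ₑ ∂μ ≤ C * (1 + ∫⁻ x in B, ‖u x‖ₑ ∂μ)

omit [FiniteDimensional ℝ E] [BorelSpace E] [μ.IsAddHaarMeasure] in
theorem L1Ctrl.mono {U B A A' : Set E} (h : L1Ctrl μ U B A) (hA : A' ⊆ A) : L1Ctrl μ U B A' := by
  obtain ⟨C, hC, h⟩ := h
  exact ⟨C, hC, fun u hu => (lintegral_mono_set hA).trans (h u hu)⟩

omit [FiniteDimensional ℝ E] [BorelSpace E] [μ.IsAddHaarMeasure] in
theorem L1Ctrl.union {U B A A' : Set E} (h : L1Ctrl μ U B A) (h' : L1Ctrl μ U B A') :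
    L1Ctrl μ U B (A ∪ A') := by
  obtain ⟨C, hC, h⟩ := h
  obtain ⟨C', hC', h'⟩ := h'
  refine ⟨C + C', ENNReal.add_ne_top.2 ⟨hC, hC'⟩, fun u hu => ?_⟩
  rw [add_mul]
  exact (lintegral_union_le _ _ _).trans (add_le_add (h u hu) (h' u hu))

omit [FiniteDimensional ℝ E] [BorelSpace E] [μ.IsAddHaarMeasure] in
theorem L1Ctrl.empty {U B : Set E} : L1Ctrl μ U B ∅ := ⟨0, by simp, by simp⟩

omit [FiniteDimensional ℝ E] [BorelSpace E] [μ.IsAddHaarMeasure] in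
theorem L1Ctrl.self {U B : Set E} : L1Ctrl μ U B B :=
  ⟨1, by simp, fun u _ => by rw [one_mul]; exact le_add_self⟩

/-- Integrate `|u y| ≤ |u y - u x| + |u x|` over `x ∈ A` and `y` in the ball, then divide by `μ A`:
control on a piece of positive measure gives control on the whole ball. -/
theorem L1Ctrl.ball {U B A : Set E} (h : L1Ctrl μ U B A) {a : E} {r : ℝ} (hr : 0 < r)
    (hU : Metric.closedBall a (4 * r) ⊆ U) (hA : A ⊆ Metric.ball a r) (hA0 : μ A ≠ 0) :
    L1Ctrl μ U B (Metric.ball a r) := by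
  obtain ⟨C, hC, h⟩ := h
  set D := Metric.ball a r with hD
  set M := ENNReal.ofReal (2 * r) * μ (Metric.ball (0 : E) (2 * r))
  have hM : M ≠ ∞ := ENNReal.mul_ne_top ENNReal.ofReal_ne_top measure_ball_lt_top.ne
  have hDtop : μ D ≠ ∞ := measure_ball_lt_top.ne
  have hAtop : μ A ≠ ∞ := (measure_mono hA |>.trans_lt measure_ball_lt_top).ne
  refine ⟨(μ A)⁻¹ * (M + μ D * C), ENNReal.mul_ne_top (ENNReal.inv_ne_top.2 hA0)
    (ENNReal.add_ne_top.2 ⟨hM, ENNReal.mul_ne_top hDtop hC⟩), fun u hu => ?_⟩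
  set I := ∫⁻ x in B, ‖u x‖ₑ ∂μ
  have hum : Measurable fun x => ‖u x‖ₑ := hu.measurable.enorm
  have hz : Measurable fun z : E × E => ‖u z.2 - u z.1‖ₑ :=
    ((hu.measurable.comp measurable_snd).sub (hu.measurable.comp measurable_fst)).enorm
  have key : μ A * ∫⁻ y in D, ‖u y‖ₑ ∂μ ≤ (M + μ D * C) * (1 + I) := by
    calc μ A * ∫⁻ y in D, ‖u y‖ₑ ∂μ = ∫⁻ _ in A, (∫⁻ y in D, ‖u y‖ₑ ∂μ) ∂μ := by
          rw [setLIntegral_const, mul_comm]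
      _ ≤ ∫⁻ x in A, (∫⁻ y in D, ‖u y - u x‖ₑ ∂μ + μ D * ‖u x‖ₑ) ∂μ := by
          refine lintegral_mono fun x => ?_
          have : μ D * ‖u x‖ₑ = ∫⁻ _ in D, ‖u x‖ₑ ∂μ := by rw [setLIntegral_const, mul_comm]
          rw [this, ← lintegral_add_right _ measurable_const]
          refine lintegral_mono fun y => ?_
          simpa using enorm_add_le (u y - u x) (u x)
      _ = ∫⁻ x in A, ∫⁻ y in D, ‖u y - u x‖ₑ ∂μ ∂μ + μ D * ∫⁻ x in A, ‖u x‖ₑ ∂μ := by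
          rw [lintegral_add_right _ (hum.const_mul _), lintegral_const_mul _ hum]
      _ ≤ M + μ D * (C * (1 + I)) := by
          gcongr
          · exact (lintegral_mono_set hA).trans (lintegral_lintegral_ball_sub_le hu hr hU)
          · exact h u hu
      _ ≤ (M + μ D * C) * (1 + I) := by
          rw [add_mul]
          exact add_le_add (le_mul_of_one_le_right' le_self_add) (mul_assoc _ _ _).ge
  calc ∫⁻ y in D, ‖u y‖ₑ ∂μ = (μ A)⁻¹ * (μ A * ∫⁻ y in D, ‖u y‖ₑ ∂μ) := by
        rw [← mul_assoc, ENNReal.inv_mul_cancel hA0 hAtop, one_mul]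
    _ ≤ _ := by rw [mul_assoc]; gcongr

/-- Connectedness: the set of centres of controlled balls is open, and by `L1Ctrl.ball` it is closed
relative to `U`. -/
theorem L1Ctrl.exists_ball_of_mem {U : Set E} (hUo : IsOpen U) (hUc : IsConnected U)
    {a : E} {r : ℝ} (hr : 0 < r) (ha : a ∈ U) :
    ∀ x ∈ U, ∃ ρ > 0, L1Ctrl μ U (Metric.ball a r) (Metric.ball x ρ) := by
  set G : Set E := {x | ∃ ρ > 0, L1Ctrl μ U (Metric.ball a r) (Metric.ball x ρ)} with hG
  have hsmall : ∀ x y : E, ∀ ρ : ℝ, y ∈ Metric.ball x ρ → ∃ δ > 0, Metric.ball y δ ⊆ Metric.ball x ρ :=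
    fun x y ρ hy => Metric.isOpen_iff.1 Metric.isOpen_ball y hy
  have hGo : IsOpen G := by
    refine Metric.isOpen_iff.2 fun x ⟨ρ, hρ, hx⟩ => ⟨ρ, hρ, fun y hy => ?_⟩
    obtain ⟨δ, hδ, hsub⟩ := hsmall x y ρ hy
    exact ⟨δ, hδ, hx.mono hsub⟩
  have hsub : U ⊆ G := by
    refine hUc.isPreconnected.subset_of_closure_inter_subset hGo
      ⟨a, ha, r, hr, L1Ctrl.self⟩ ?_
    rintro x ⟨hxc, hxU⟩
    obtain ⟨ε, hε, hball⟩ := Metric.isOpen_iff.1 hUo x hxU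
    have hρ : 0 < ε / 8 := by positivity
    obtain ⟨y, ⟨δ, hδ, hy⟩, hyx⟩ := Metric.mem_closure_iff.1 hxc (ε / 8) hρ
    obtain ⟨δ', hδ', hsub⟩ := hsmall x y (ε / 8) (by rwa [Metric.mem_ball, dist_comm])
    have h1 : L1Ctrl μ U (Metric.ball a r) (Metric.ball y (min δ δ')) :=
      hy.mono (Metric.ball_subset_ball (min_le_left _ _))
    refine ⟨ε / 8, hρ, h1.ball hρ ?_ ((Metric.ball_subset_ball (min_le_right _ _)).trans hsub) ?_⟩
    · exact (Metric.closedBall_subset_ball (by linarith)).trans hball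
    · exact (Metric.measure_ball_pos μ y (lt_min hδ hδ')).ne'
  exact hsub

theorem L1Ctrl.compact {U : Set E} (hUo : IsOpen U) (hUc : IsConnected U)
    {a : E} {r : ℝ} (hr : 0 < r) (ha : a ∈ U) {K : Set E} (hK : IsCompact K) (hKU : K ⊆ U) :
    L1Ctrl μ U (Metric.ball a r) K := by
  refine hK.induction_on L1Ctrl.empty (fun s t hst ht => ht.mono hst)
    (fun s t hs ht => hs.union ht) fun x hx => ?_
  obtain ⟨ρ, hρ, h⟩ := L1Ctrl.exists_ball_of_mem (μ := μ) hUo hUc hr ha x (hKU hx)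
  exact ⟨_, mem_nhdsWithin_of_mem_nhds (Metric.ball_mem_nhds x hρ), h⟩

/-- Moving `U ∩ ball x₀ R` by `R` along the cone axis sends it into a compact subset of `U`, where
control is already known, and the translation estimate charges at most `R` for the move. Since that
estimate needs a margin inside `U`, the move starts from the set displaced by a small `t > 0`. -/
theorem L1Ctrl.cone {U : Set E} (hUo : IsOpen U) (hUb : Bornology.IsBounded U) (hUc : IsConnected U)
    {a : E} {r : ℝ} (hr : 0 < r) (ha : a ∈ U) {x₀ ν : E} {R κ : ℝ} (hν : ‖ν‖ = 1) (hR : 0 < R)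
    (hκ : 0 < κ)
    (hcone : ∀ x ∈ U, dist x x₀ < R → ∀ v, ‖v - ν‖ ≤ κ → ∀ s, 0 ≤ s → s ≤ R → x + s • v ∈ U) :
    L1Ctrl μ U (Metric.ball a r) (U ∩ Metric.ball x₀ R) := by
  set A : Set E := U ∩ Metric.ball x₀ R with hA
  have hAo : IsOpen A := hUo.inter Metric.isOpen_ball
  -- The cone at `x` contains the ball of radius `s * κ` about `x + s • ν`.
  have hball : ∀ x ∈ A, ∀ s, 0 < s → s ≤ R → Metric.closedBall (x + s • ν) (s * κ) ⊆ U := by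
    intro x hx s hs hsR y hy
    have h := hcone x hx.1 hx.2 (s⁻¹ • (y - x)) ?_ s hs.le hsR
    · rwa [smul_smul, mul_inv_cancel₀ hs.ne', one_smul, add_sub_cancel] at h
    · have h1 : s⁻¹ • (y - x) - ν = s⁻¹ • (y - (x + s • ν)) := by
        rw [smul_sub, smul_sub, smul_add, smul_smul, inv_mul_cancel₀ hs.ne', one_smul]
        abel
      rw [h1, norm_smul, norm_inv, Real.norm_eq_abs, abs_of_pos hs, inv_mul_le_iff₀ hs]
      rwa [Metric.mem_closedBall, dist_eq_norm] at hy
  -- `T t` is `A + t • ν`; moving it further along `ν`, up to `T R`, keeps a margin `t * κ` inside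
  -- `U`.
  set T : ℝ → Set E := fun t => (fun y => y - t • ν) ⁻¹' A with hT
  have hTo : ∀ t, IsOpen (T t) := fun t => hAo.preimage (by fun_prop)
  have hTb : ∀ t, Bornology.IsBounded (T t) := fun t =>
    isBounded_preimage_sub (hUb.subset inter_subset_left) _
  set K := closure (T R) with hK
  have hKc : IsCompact K :=
    Metric.isCompact_of_isClosed_isBounded isClosed_closure (hTb R).closure
  have hKU : K ⊆ U := by
    intro y hy
    obtain ⟨z, hz, hyz⟩ := Metric.mem_closure_iff.1 hy (R * κ) (by positivity)
    have := hball _ hz R hR le_rfl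
    rw [sub_add_cancel] at this
    exact this (Metric.mem_closedBall.2 hyz.le)
  obtain ⟨C, hC, hCK⟩ := L1Ctrl.compact (μ := μ) hUo hUc hr ha hKc hKU
  refine ⟨C + ENNReal.ofReal R, ENNReal.add_ne_top.2 ⟨hC, ENNReal.ofReal_ne_top⟩, fun u hu => ?_⟩
  set I := ∫⁻ x in Metric.ball a r, ‖u x‖ₑ ∂μ
  have hum : Measurable fun x => ‖u x‖ₑ := hu.measurable.enorm
  have hbound : ∀ t, 0 < t → t ≤ R → ∫⁻ x in T t, ‖u x‖ₑ ∂μ ≤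
      (C + ENNReal.ofReal R) * (1 + I) := by
    intro t ht htR
    set h := (R - t) • ν with hh
    have h1 : ∫⁻ x in T t, ‖u (x + h) - u x‖ₑ ∂μ ≤ ENNReal.ofReal R := by
      refine (lintegral_add_sub_le hu (hTo t) (hTb t) (r := t * κ) (by positivity)
        fun x hx s hs0 hs1 => ?_).trans ?_
      · have h2 := hball _ hx (t + s * (R - t)) (by nlinarith) (by nlinarith)
        have h3 : x - t • ν + (t + s * (R - t)) • ν = x + s • h := by
          rw [hh]; module
        rw [h3] at h2
        refine (Metric.closedBall_subset_closedBall ?_).trans h2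
        have : 0 ≤ s * (R - t) := mul_nonneg hs0 (by linarith)
        nlinarith
      · rw [← ofReal_norm, hh, norm_smul, hν, mul_one, Real.norm_eq_abs,
          abs_of_nonneg (by linarith)]
        exact ENNReal.ofReal_le_ofReal (by linarith)
    have h2 : ∫⁻ x in T t, ‖u (x + h)‖ₑ ∂μ ≤ C * (1 + I) := by
      rw [setLIntegral_comp_add_right (f := fun x => ‖u x‖ₑ)]
      refine (lintegral_mono_set ?_).trans (hCK u hu)
      intro y hy
      refine subset_closure ?_
      have h3 : y - h - t • ν = y - R • ν := by rw [hh]; module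
      change y - R • ν ∈ A
      rw [← h3]; exact hy
    calc ∫⁻ x in T t, ‖u x‖ₑ ∂μ ≤ ∫⁻ x in T t, (‖u (x + h)‖ₑ + ‖u (x + h) - u x‖ₑ) ∂μ := by
          refine lintegral_mono fun x => ?_
          have := enorm_sub_le (E := ℝ) (a := u (x + h)) (b := u (x + h) - u x)
          simpa using this
      _ = ∫⁻ x in T t, ‖u (x + h)‖ₑ ∂μ + ∫⁻ x in T t, ‖u (x + h) - u x‖ₑ ∂μ :=
          lintegral_add_left (hum.comp (measurable_add_const h)) _
      _ ≤ C * (1 + I) + ENNReal.ofReal R := add_le_add h2 h1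
      _ ≤ _ := by
          rw [add_mul]
          gcongr
          exact le_mul_of_one_le_right' le_self_add
  -- Let the displacement tend to zero: `A` is open, so each of its points eventually lies in `T (t
  -- n)`, and Fatou applies.
  set t : ℕ → ℝ := fun n => R / (n + 1) with ht
  have ht0 : Tendsto t atTop (𝓝 0) := by
    simpa [ht, Function.comp_def] using
      (tendsto_const_div_atTop_nhds_zero_nat R).comp (tendsto_add_atTop_nat 1)
  rw [← lintegral_indicator hAo.measurableSet]
  calc ∫⁻ x, A.indicator (fun x => ‖u x‖ₑ) x ∂μ
      ≤ ∫⁻ x, liminf (fun n => (T (t n)).indicator (fun x => ‖u x‖ₑ) x) atTop ∂μ := by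
        refine lintegral_mono fun x => ?_
        by_cases hx : x ∈ A
        · rw [indicator_of_mem hx]
          have h1 : Tendsto (fun n => x - t n • ν) atTop (𝓝 x) := by
            simpa using tendsto_const_nhds.sub (ht0.smul_const ν)
          refine le_liminf_of_le (by isBoundedDefault) ?_
          filter_upwards [h1.eventually (hAo.mem_nhds hx)] with n hn
          rw [indicator_of_mem (show x ∈ T (t n) from hn)]
        · rw [indicator_of_notMem hx]; exact zero_le
    _ ≤ liminf (fun n => ∫⁻ x, (T (t n)).indicator (fun x => ‖u x‖ₑ) x ∂μ) atTop :=
        lintegral_liminf_le fun n => hum.indicator (hTo _).measurableSet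
    _ ≤ _ := by
        refine liminf_le_of_frequently_le' (Frequently.of_forall fun n => ?_)
        rw [lintegral_indicator (hTo _).measurableSet]
        exact hbound _ (by positivity)
          (div_le_self hR.le (by linarith [n.cast_nonneg (α := ℝ)]))

theorem L1Ctrl.domain {U : Set E} (hUo : IsOpen U) (hUb : Bornology.IsBounded U)
    (hUc : IsConnected U) (hcone : UniformCone U) {a : E} {r : ℝ} (hr : 0 < r) (ha : a ∈ U) :
    L1Ctrl μ U (Metric.ball a r) U := by
  have hcl : IsCompact (closure U) :=
    Metric.isCompact_of_isClosed_isBounded isClosed_closure hUb.closure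
  have h : L1Ctrl μ U (Metric.ball a r) (U ∩ closure U) := by
    refine hcl.induction_on (p := fun s => L1Ctrl μ U (Metric.ball a r) (U ∩ s)) ?_
      (fun s t hst ht => ht.mono (inter_subset_inter_right _ hst))
      (fun s t hs ht => by rw [inter_union_distrib_left]; exact hs.union ht) fun x hx => ?_
    · rw [inter_empty]; exact L1Ctrl.empty
    · obtain ⟨ν, R, κ, hν, hR, hκ, -, hc⟩ := hcone x hx
      exact ⟨_, mem_nhdsWithin_of_mem_nhds (Metric.ball_mem_nhds x hR),
        L1Ctrl.cone hUo hUb hUc hr ha hν hR hκ hc⟩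
  exact h.mono fun x hx => ⟨hx, subset_closure hx⟩

/-- The `L¹` Poincaré inequality for functions of bounded variation. -/
theorem exists_lintegral_sub_const_le {U : Set E} (hUo : IsOpen U) (hUb : Bornology.IsBounded U)
    (hUc : IsConnected U) (hcone : UniformCone U) :
    ∃ C : ℝ≥0∞, C ≠ ∞ ∧ ∀ u, IsUnitVar μ U u → ∃ c : ℝ, ∫⁻ x in U, ‖u x - c‖ₑ ∂μ ≤ C := by
  obtain ⟨a, ha⟩ := hUc.nonempty
  obtain ⟨ε, hε, hball⟩ := Metric.isOpen_iff.1 hUo a ha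
  set r := ε / 8
  have hr : 0 < r := by positivity
  have hrU : Metric.closedBall a (4 * r) ⊆ U :=
    (Metric.closedBall_subset_ball (by simp only [r]; linarith)).trans hball
  obtain ⟨C, hC, hL⟩ := L1Ctrl.domain (μ := μ) hUo hUb hUc hcone hr ha
  set D := Metric.ball a r
  have hDU : D ⊆ U := (Metric.ball_subset_closedBall.trans
    (Metric.closedBall_subset_closedBall (by linarith))).trans hrU
  set M := ENNReal.ofReal (2 * r) * μ (Metric.ball (0 : E) (2 * r))
  have hM : M ≠ ∞ := ENNReal.mul_ne_top ENNReal.ofReal_ne_top measure_ball_lt_top.ne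
  have hD0 : μ D ≠ 0 := (Metric.measure_ball_pos μ a hr).ne'
  refine ⟨C * (1 + M / μ D), ENNReal.mul_ne_top hC (ENNReal.add_ne_top.2
    ⟨ENNReal.one_ne_top, (ENNReal.div_lt_top hM hD0).ne⟩), fun u hu => ?_⟩
  have hz : Measurable fun z : E × E => ‖u z.2 - u z.1‖ₑ :=
    ((hu.measurable.comp measurable_snd).sub (hu.measurable.comp measurable_fst)).enorm
  -- The constant is a value `u x` at a point where the oscillation over `D` does not exceed its
  -- average; `L¹` control is then applied to `u - u x`.
  obtain ⟨x, hx, hxle⟩ := exists_le_setLAverage (μ := μ) (s := D)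
    (f := fun x => ∫⁻ y in D, ‖u y - u x‖ₑ ∂μ) hD0 measure_ball_lt_top.ne
    (hz.lintegral_prod_right').aemeasurable
  refine ⟨u x, ?_⟩
  have hv := hL _ (hu.sub_const hUo hUb (u x))
  have h1 : ∀ s ⊆ U, MeasurableSet s →
      ∫⁻ y in s, ‖u y - U.indicator (fun _ => u x) y‖ₑ ∂μ = ∫⁻ y in s, ‖u y - u x‖ₑ ∂μ :=
    fun s hs hsm => setLIntegral_congr_fun hsm fun y hy => by simp [hs hy]
  rw [h1 U Subset.rfl hUo.measurableSet, h1 D hDU measurableSet_ball] at hv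
  refine hv.trans ?_
  gcongr
  refine hxle.trans ?_
  rw [setLAverage_eq]
  gcongr
  exact lintegral_lintegral_ball_sub_le hu hr hrU

end Poincare

/-! ### The Sobolev inequality at the critical exponent. -/

section Sobolev

variable {E : Type*} [NormedAddCommGroup E] [InnerProductSpace ℝ E] [FiniteDimensional ℝ E]
  [MeasurableSpace E] [BorelSpace E] {μ : Measure E} [μ.IsAddHaarMeasure]

-- A ball spans the space, so a basis can be extracted from it. All basis directions then lie in the
-- cone around `ν`.
omit [MeasurableSpace E] [BorelSpace E] in
theorem exists_basis_mem_closedBall (ν : E) {κ : ℝ} (hκ : 0 < κ) :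
    ∃ b : Module.Basis (Fin (Module.finrank ℝ E)) ℝ E, ∀ i, ‖b i - ν‖ ≤ κ := by
  obtain ⟨s, hs, hspan, hli⟩ := exists_linearIndependent ℝ (Metric.ball ν κ)
  have htop : Submodule.span ℝ (Metric.ball ν κ) = ⊤ := by
    refine Submodule.eq_top_of_nonempty_interior' _ ⟨ν, ?_⟩
    exact interior_mono Submodule.subset_span
      (by rw [Metric.isOpen_ball.interior_eq]; exact Metric.mem_ball_self hκ)
  let b := Module.Basis.mk hli (by rw [Subtype.range_coe, hspan, htop])
  have : Finite s := Module.Finite.finite_basis b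
  have := Fintype.ofFinite s
  have hcard : Fintype.card s = Module.finrank ℝ E := (Module.finrank_eq_card_basis b).symm
  refine ⟨b.reindex (Fintype.equivFinOfCardEq hcard), fun i => ?_⟩
  have h := hs ((Fintype.equivFinOfCardEq hcard).symm i).2
  rw [Metric.mem_ball, dist_eq_norm] at h
  simpa [b] using h.le

/-- The Gagliardo-Nirenberg inequality for a function dominated by line integrals of `G`
in the directions of a basis. -/
theorem exists_lintegral_rpow_le_of_le_line {n : ℕ} (hn : 2 ≤ n) (b : Module.Basis (Fin n) ℝ E) :
    ∃ C : ℝ≥0∞, C ≠ ∞ ∧ ∀ f G : E → ℝ≥0∞, Measurable G →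
      (∀ i x, f x ≤ ∫⁻ s : ℝ, G (x + s • b i)) →
      ∫⁻ x, f x ^ ((n : ℝ) / (n - 1)) ∂μ ≤ C * (∫⁻ x, G x ∂μ) ^ ((n : ℝ) / (n - 1)) := by
  have hn1 : (0 : ℝ) < n - 1 := by
    have : (2 : ℝ) ≤ n := by exact_mod_cast hn
    linarith
  set q : ℝ := (n : ℝ) / (n - 1)
  have hq : Real.HolderConjugate (Fintype.card (Fin n)) q := by
    rw [Real.holderConjugate_iff_eq_conjExponent]
    · simp [q]
    · simp only [Fintype.card_fin]; linarith
  have hq0 : 0 ≤ q := hq.symm.pos.le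
  -- `T` turns the lines parallel to the `b i` into coordinate lines. Haar measures differ by a
  -- scalar, so the grid-lines inequality on `ℝⁿ` carries over to `E`.
  set T : (Fin n → ℝ) ≃L[ℝ] E := b.equivFun.symm.toContinuousLinearEquiv with hT
  have hTm : MeasurableEmbedding T := T.toHomeomorph.measurableEmbedding
  set ν : Measure E := Measure.map T volume
  have : ν.IsAddHaarMeasure := T.isAddHaarMeasure_map volume
  set c := μ.addHaarScalarFactor ν
  set c' := ν.addHaarScalarFactor μ
  have hμ : μ = c • ν := Measure.isAddLeftInvariant_eq_smul μ ν
  have hν : ν = c' • μ := Measure.isAddLeftInvariant_eq_smul ν μ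
  have hcov : ∀ f : E → ℝ≥0∞, ∫⁻ x, f x ∂ν = ∫⁻ y, f (T y) := fun f => hTm.lintegral_map f
  refine ⟨c * (c' : ℝ≥0∞) ^ q, ENNReal.mul_ne_top ENNReal.coe_ne_top
    (ENNReal.rpow_ne_top_of_nonneg hq0 ENNReal.coe_ne_top), fun f G hG hfG => ?_⟩
  have hup : ∀ (y : Fin n → ℝ) (i : Fin n) (s : ℝ),
      T y + s • b i = T (Function.update y i (s + y i)) := by
    intro y i s
    have h1 : Function.update y i (s + y i) = y + s • Pi.single i 1 := by
      ext j
      rcases eq_or_ne j i with rfl | h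
      · simp [add_comm]
      · simp [h]
    have h2 : T (Pi.single i 1) = b i := by
      simp [hT]
    rw [h1, map_add, map_smul, h2]
  have hline : ∀ y i, f (T y) ≤ ∫⁻ t : ℝ, G (T (Function.update y i t)) := by
    intro y i
    refine (hfG i (T y)).trans_eq ?_
    simp_rw [hup]
    exact lintegral_add_right_eq_self (μ := volume)
      (fun t => G (T (Function.update y i t))) (y i)
  have key : ∫⁻ y, f (T y) ^ q ≤ (∫⁻ y, G (T y)) ^ q := by
    refine le_trans (lintegral_mono fun y => ?_)
      (lintegral_prod_lintegral_pow_le (fun _ : Fin n => (volume : Measure ℝ)) hq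
        (hG.comp T.continuous.measurable))
    -- `f ^ q` is a product of `n` factors `f ^ (1 / (n - 1))`, and the `i`-th factor is bounded by
    -- the line integral in direction `b i`.
    calc f (T y) ^ q = ∏ i : Fin n, f (T y) ^ ((1 : ℝ) / (Fintype.card (Fin n) - 1 : ℝ)) := by
          rw [Finset.prod_const, Finset.card_univ, ← ENNReal.rpow_natCast, ← ENNReal.rpow_mul]
          congr 1
          simp only [Fintype.card_fin, q]
          ring
      _ ≤ _ := by
          refine Finset.prod_le_prod' fun i _ => ?_
          refine ENNReal.rpow_le_rpow (hline y i) ?_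
          simp only [Fintype.card_fin]; positivity
  calc ∫⁻ x, f x ^ q ∂μ = c * ∫⁻ x, f x ^ q ∂ν := by
        conv_lhs => rw [hμ]
        rw [lintegral_smul_measure]; rfl
    _ = c * ∫⁻ y, f (T y) ^ q := by rw [hcov]
    _ ≤ c * (∫⁻ y, G (T y)) ^ q := by gcongr
    _ = c * (c' * ∫⁻ x, G x ∂μ) ^ q := by
        rw [← hcov]
        conv_lhs => rw [hν]
        rw [lintegral_smul_measure]; rfl
    _ = _ := by rw [ENNReal.mul_rpow_of_nonneg _ _ hq0, mul_assoc]

theorem lintegral_enorm_mollify_le (φ : ContDiffBump (0 : E)) {u : E → ℝ} (hu : Measurable u) :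
    ∫⁻ x, ‖mollify μ φ u x‖ₑ ∂μ ≤ ∫⁻ x, ‖u x‖ₑ ∂μ := by
  have hk : Continuous (φ.normed μ) := φ.continuous_normed
  have hki : Integrable (φ.normed μ) μ := φ.integrable_normed
  have h1 : ∫⁻ x, ‖φ.normed μ x‖ₑ ∂μ = 1 := by
    rw [← ofReal_integral_norm_eq_lintegral_enorm hki]
    have : ∀ x, ‖φ.normed μ x‖ = φ.normed μ x := fun x =>
      by rw [Real.norm_eq_abs, abs_of_nonneg (φ.nonneg_normed _)]
    simp_rw [this, φ.integral_normed, ENNReal.ofReal_one]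
  calc ∫⁻ x, ‖mollify μ φ u x‖ₑ ∂μ
      ≤ ∫⁻ x, ∫⁻ y, ‖φ.normed μ (x - y)‖ₑ * ‖u y‖ₑ ∂μ ∂μ := by
        refine lintegral_mono fun x => ?_
        rw [mollify_eq]
        refine (enorm_integral_le_lintegral_enorm _).trans_eq ?_
        simp_rw [enorm_mul]
    _ = ∫⁻ y, ∫⁻ x, ‖φ.normed μ (x - y)‖ₑ * ‖u y‖ₑ ∂μ ∂μ := by
        refine lintegral_lintegral_swap (Measurable.aemeasurable ?_)
        exact (hk.measurable.comp (measurable_fst.sub measurable_snd)).enorm.mul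
          (hu.comp measurable_snd).enorm
    _ = ∫⁻ y, ‖u y‖ₑ ∂μ := by
        refine lintegral_congr fun y => ?_
        rw [lintegral_mul_const' _ _ enorm_ne_top,
          lintegral_sub_right_eq_self (fun x => ‖φ.normed μ x‖ₑ), h1, one_mul]

omit [FiniteDimensional ℝ E] [MeasurableSpace E] [BorelSpace E] in
theorem enorm_le_lintegral_fderiv {f : E → ℝ} (hf : ContDiff ℝ 1 f) (x v : E) {R : ℝ}
    (hR : 0 ≤ R) (h0 : f (x + R • v) = 0) :
    ‖f x‖ₑ ≤ ∫⁻ s in Ioc 0 R, ‖fderiv ℝ f (x + s • v) v‖ₑ := by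
  have hder : ∀ s ∈ uIcc (0 : ℝ) R,
      HasDerivAt (fun s : ℝ => f (x + s • v)) (fderiv ℝ f (x + s • v) v) s := by
    intro s _
    have h1 : HasDerivAt (fun s : ℝ => x + s • v) v s := by
      simpa using ((hasDerivAt_id s).smul_const v).const_add x
    exact ((hf.differentiable one_ne_zero) (x + s • v)).hasFDerivAt.comp_hasDerivAt s h1
  have hcont : Continuous fun s : ℝ => fderiv ℝ f (x + s • v) v :=
    ((hf.continuous_fderiv one_ne_zero).comp (by fun_prop)).clm_apply continuous_const
  have := intervalIntegral.integral_eq_sub_of_hasDerivAt hder (hcont.intervalIntegrable _ _)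
  simp only [h0, zero_smul, add_zero, zero_sub] at this
  rw [← enorm_neg, ← this, intervalIntegral.integral_of_le hR]
  exact enorm_integral_le_lintegral_enorm _

/-- Local Sobolev estimate near a point at which the cone condition holds. -/
theorem exists_local_sobolev (hn : 2 ≤ Module.finrank ℝ E) {U : Set E} (hUo : IsOpen U)
    {x₀ ν : E} {R κ : ℝ} (hν : ‖ν‖ = 1) (hR : 0 < R) (hκ : 0 < κ) (hκ2 : κ ≤ 1 / 2)
    (hcone : ∀ x ∈ U, dist x x₀ < R → ∀ v, ‖v - ν‖ ≤ κ → ∀ s, 0 ≤ s → s ≤ R → x + s • v ∈ U)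
    {q : ℝ} (hq : q = (Module.finrank ℝ E : ℝ) / (Module.finrank ℝ E - 1)) :
    ∃ C : ℝ≥0∞, C ≠ ∞ ∧ ∀ u, IsUnitVar μ U u →
      ∫⁻ x in U ∩ Metric.ball x₀ (R / 8), ‖u x‖ₑ ^ q ∂μ ≤ C * (1 + ∫⁻ x, ‖u x‖ₑ ∂μ) ^ q := by
  have hq0 : 0 ≤ q := by
    have : (2 : ℝ) ≤ Module.finrank ℝ E := by exact_mod_cast hn
    rw [hq]
    exact div_nonneg (by linarith) (by linarith)
  -- A segment of length parameter `R` in direction `b i` from a point of `U` near `x₀` never leaves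
  -- `U`, and it outlasts the support of the cutoff; this replaces an extension of `u` beyond `U`.
  obtain ⟨b, hb⟩ := exists_basis_mem_closedBall ν hκ
  obtain ⟨C, hC, hGN⟩ := exists_lintegral_rpow_le_of_le_line (μ := μ) hn b
  rw [← hq] at hGN
  obtain ⟨χ, hχ, hχc, hχs, hχ0, hχ1, hχK⟩ := exists_cutoff
    (isCompact_closedBall x₀ (R / 8)) (Metric.isOpen_ball (x := x₀) (ε := R / 4))
    (Metric.closedBall_subset_ball (by linarith))
  obtain ⟨L, hL⟩ := (hχ.continuous_fderiv one_ne_zero).bounded_above_of_compact_support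
    (hχc.fderiv (𝕜 := ℝ))
  have hL0 : 0 ≤ L := (norm_nonneg _).trans (hL x₀)
  have hbn : ∀ i, 1 / 2 ≤ ‖b i‖ ∧ ‖b i‖ ≤ 2 := by
    intro i
    have h1 := norm_sub_norm_le ν (b i)
    have h2 := norm_sub_norm_le (b i) ν
    rw [norm_sub_rev] at h1
    constructor <;> linarith [hb i]
  set M : ℝ≥0∞ := Module.finrank ℝ E * (2 + ENNReal.ofReal (2 * L)) with hM
  have hMtop : M ≠ ∞ := ENNReal.mul_ne_top (ENNReal.natCast_ne_top _)
    (ENNReal.add_ne_top.2 ⟨by simp, ENNReal.ofReal_ne_top⟩)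
  refine ⟨C * M ^ q, ENNReal.mul_ne_top hC (ENNReal.rpow_ne_top_of_nonneg hq0 hMtop),
    fun u hu => ?_⟩
  set I := ∫⁻ x, ‖u x‖ₑ ∂μ
  set W : Set E := U ∩ Metric.ball x₀ R with hW
  have hWo : IsOpen W := hUo.inter Metric.isOpen_ball
  have hball : ∀ x ∈ W, ∀ s, 0 < s → s ≤ R → Metric.closedBall (x + s • ν) (s * κ) ⊆ U := by
    intro x hx s hs hsR y hy
    have h := hcone x hx.1 hx.2 (s⁻¹ • (y - x)) ?_ s hs.le hsR
    · rwa [smul_smul, mul_inv_cancel₀ hs.ne', one_smul, add_sub_cancel] at h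
    · have h1 : s⁻¹ • (y - x) - ν = s⁻¹ • (y - (x + s • ν)) := by
        rw [smul_sub, smul_sub, smul_add, smul_smul, inv_mul_cancel₀ hs.ne', one_smul]
        abel
      rw [h1, norm_smul, norm_inv, Real.norm_eq_abs, abs_of_pos hs, inv_mul_le_iff₀ hs]
      rwa [Metric.mem_closedBall, dist_eq_norm] at hy
  -- Shifting by `t • ν` before mollifying at radius `t * κ` gives a smooth function whose
  -- derivatives are controlled on all of `W`, up to the boundary of `U`.
  have hsmooth : ∀ t (ht : 0 < t), t ≤ R →
      ∫⁻ x in U ∩ Metric.ball x₀ (R / 8),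
        ‖mollify μ (halfBump (t * κ) (mul_pos ht hκ)) u (x + t • ν)‖ₑ ^ q ∂μ ≤
        C * M ^ q * (1 + I) ^ q := by
    intro t ht htR
    set φ : ContDiffBump (0 : E) := halfBump (t * κ) (mul_pos ht hκ)
    set w : E → ℝ := fun x => mollify μ φ u (x + t • ν) with hw
    have hwd : ContDiff ℝ 1 w :=
      (contDiff_mollify (n := 1) φ hu.integrable).comp (contDiff_id.add contDiff_const)
    have hwf : ∀ x e, fderiv ℝ w x e = fderiv ℝ (mollify μ φ u) (x + t • ν) e := by
      intro x e
      rw [hw, fderiv_comp_add_right]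
    have hwI : ∫⁻ x, ‖w x‖ₑ ∂μ ≤ I := by
      rw [hw, lintegral_add_right_eq_self (fun x => ‖mollify μ φ u x‖ₑ)]
      exact lintegral_enorm_mollify_le φ hu.measurable
    have hwD : ∀ e, ∫⁻ x in W, ‖fderiv ℝ w x e‖ₑ ∂μ ≤ ‖e‖ₑ := by
      intro e
      simp_rw [hwf]
      rw [setLIntegral_comp_add_right (f := fun x => ‖fderiv ℝ (mollify μ φ u) x e‖ₑ)]
      refine lintegral_fderiv_mollify_le_enorm hu.integrable hu.dirVarLE φ e
        (hWo.preimage (by fun_prop))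
        (isBounded_preimage_sub (Metric.isBounded_ball.subset inter_subset_right) _) ?_
      intro y hy
      have := hball _ hy t ht htR
      rwa [sub_add_cancel] at this
    set p : E → ℝ := fun x => χ x * w x with hp
    have hpd : ContDiff ℝ 1 p := hχ.mul hwd
    have hpf : ∀ x e, ‖fderiv ℝ p x e‖ₑ ≤ ‖fderiv ℝ w x e‖ₑ + ENNReal.ofReal L * ‖e‖ₑ * ‖w x‖ₑ := by
      intro x e
      have h1 : fderiv ℝ p x e = χ x * fderiv ℝ w x e + w x * fderiv ℝ χ x e := by
        rw [hp, fderiv_fun_mul ((hχ.differentiable one_ne_zero) x)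
          ((hwd.differentiable one_ne_zero) x)]
        rfl
      rw [h1]
      refine (enorm_add_le _ _).trans (add_le_add ?_ ?_)
      · rw [enorm_mul]
        refine mul_le_of_le_one_left' ?_
        rw [← ofReal_norm, Real.norm_eq_abs, abs_of_nonneg (hχ0 x)]
        exact ENNReal.ofReal_le_one.2 (hχ1 x)
      · rw [enorm_mul, mul_comm]
        gcongr
        rw [← ofReal_norm, ← ofReal_norm, ← ENNReal.ofReal_mul hL0]
        refine ENNReal.ofReal_le_ofReal ((ContinuousLinearMap.le_opNorm _ _).trans ?_)
        gcongr
        exact hL x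
    have hpz : ∀ x, R / 4 ≤ dist x x₀ → p x = 0 := by
      intro x hx
      have : χ x = 0 := by
        by_contra h
        exact absurd (hχs (subset_tsupport _ h)) (by simpa using hx)
      simp [hp, this]
    have hpz' : ∀ x, R / 4 ≤ dist x x₀ → fderiv ℝ p x = 0 := by
      intro x hx
      by_contra h
      have h1 : x ∈ tsupport p := support_fderiv_subset ℝ h
      have h2 : tsupport p ⊆ tsupport χ := closure_mono fun y hy h0 => hy (by simp [hp, h0])
      exact absurd (hχs (h2 h1)) (by simpa using hx)
    set G : E → ℝ≥0∞ := W.indicator fun x => ∑ i, ‖fderiv ℝ p x (b i)‖ₑ with hG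
    have hfm : ∀ e, Measurable fun x => ‖fderiv ℝ p x e‖ₑ := fun e =>
      ((hpd.continuous_fderiv one_ne_zero).clm_apply continuous_const).measurable.enorm
    have hGm : Measurable G :=
      (Finset.measurable_fun_sum _ fun i _ => hfm _).indicator hWo.measurableSet
    set f : E → ℝ≥0∞ := W.indicator fun x => ‖p x‖ₑ with hf
    have hfG : ∀ i x, f x ≤ ∫⁻ s : ℝ, G (x + s • b i) := by
      intro i x
      by_cases hx : x ∈ W
      swap
      · rw [hf, indicator_of_notMem hx]; exact zero_le
      rcases le_or_gt (R / 4) (dist x x₀) with hd | hd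
      · rw [hf, indicator_of_mem hx, hpz x hd]; simp
      rw [hf, indicator_of_mem hx]
      -- Since `‖b i‖ ≥ 1/2` and `dist x x₀ < R / 4`, the endpoint is at distance at least `R / 4`
      -- from `x₀`, outside the support of `χ`.
      have hend : p (x + R • b i) = 0 := by
        refine hpz _ ?_
        have h1 : ‖R • b i‖ ≤ dist (x + R • b i) x₀ + dist x x₀ := by
          rw [dist_eq_norm, dist_eq_norm]
          calc ‖R • b i‖ = ‖(x + R • b i - x₀) - (x - x₀)‖ := by congr 1; abel
            _ ≤ _ := norm_sub_le _ _
        rw [norm_smul, Real.norm_eq_abs, abs_of_pos hR] at h1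
        nlinarith [(hbn i).1]
      refine (enorm_le_lintegral_fderiv hpd x (b i) hR.le hend).trans ?_
      refine le_trans (setLIntegral_mono' measurableSet_Ioc fun s hs => ?_)
        (setLIntegral_le_lintegral (Ioc 0 R) _)
      by_cases hmem : x + s • b i ∈ W
      · rw [hG, indicator_of_mem hmem]
        exact Finset.single_le_sum (f := fun j => ‖fderiv ℝ p (x + s • b i) (b j)‖ₑ)
          (fun _ _ => zero_le) (Finset.mem_univ i)
      -- The cone condition keeps the segment in `U`, so it can leave `W` only by leaving `ball x₀
      -- R`, where `p` has zero derivative; truncating `G` to `W` loses nothing.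
      · have hU : x + s • b i ∈ U := hcone x hx.1 hx.2 _ (hb i) s hs.1.le hs.2
        have hfar : R / 4 ≤ dist (x + s • b i) x₀ := by
          by_contra hlt
          exact hmem ⟨hU, by rw [Metric.mem_ball]; linarith⟩
        rw [hpz' _ hfar]
        simp
    have hGint : ∫⁻ x, G x ∂μ ≤ M * (1 + I) := by
      rw [hG, lintegral_indicator hWo.measurableSet, lintegral_finsetSum _ fun i _ => hfm _]
      calc ∑ i, ∫⁻ x in W, ‖fderiv ℝ p x (b i)‖ₑ ∂μ
          ≤ ∑ _i : Fin (Module.finrank ℝ E), (2 + ENNReal.ofReal (2 * L)) * (1 + I) := by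
            refine Finset.sum_le_sum fun i _ => ?_
            have hb2 : ‖b i‖ₑ ≤ 2 := by
              rw [← ofReal_norm, ← ENNReal.ofReal_ofNat]
              exact ENNReal.ofReal_le_ofReal (hbn i).2
            have hwm : Measurable fun x => ‖w x‖ₑ := hwd.continuous.measurable.enorm
            calc ∫⁻ x in W, ‖fderiv ℝ p x (b i)‖ₑ ∂μ
                ≤ ∫⁻ x in W, (‖fderiv ℝ w x (b i)‖ₑ +
                    ENNReal.ofReal L * ‖b i‖ₑ * ‖w x‖ₑ) ∂μ := lintegral_mono fun x => hpf x _
              _ = ∫⁻ x in W, ‖fderiv ℝ w x (b i)‖ₑ ∂μ +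
                    ENNReal.ofReal L * ‖b i‖ₑ * ∫⁻ x in W, ‖w x‖ₑ ∂μ := by
                  rw [lintegral_add_right _ (hwm.const_mul _), lintegral_const_mul _ hwm]
              _ ≤ 2 + ENNReal.ofReal L * 2 * I := by
                  gcongr
                  · exact (hwD _).trans hb2
                  · exact (setLIntegral_le_lintegral _ _).trans hwI
              _ ≤ (2 + ENNReal.ofReal (2 * L)) * (1 + I) := by
                  rw [add_mul, ENNReal.ofReal_mul zero_le_two, mul_comm (ENNReal.ofReal L),
                    ENNReal.ofReal_ofNat]
                  gcongr
                  · exact le_mul_of_one_le_right' le_self_add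
                  · exact le_add_self
        _ = M * (1 + I) := by
            rw [Finset.sum_const, Finset.card_univ, Fintype.card_fin, nsmul_eq_mul, hM, mul_assoc]
    calc ∫⁻ x in U ∩ Metric.ball x₀ (R / 8), ‖w x‖ₑ ^ q ∂μ
        ≤ ∫⁻ x in U ∩ Metric.ball x₀ (R / 8), f x ^ q ∂μ := by
          refine setLIntegral_mono' (hUo.inter Metric.isOpen_ball).measurableSet fun x hx => ?_
          have hxW : x ∈ W := ⟨hx.1, Metric.ball_subset_ball (by linarith) hx.2⟩
          rw [hf, indicator_of_mem hxW, hp]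
          simp [hχK x (Metric.ball_subset_closedBall hx.2)]
      _ ≤ ∫⁻ x, f x ^ q ∂μ := setLIntegral_le_lintegral _ _
      _ ≤ C * (∫⁻ x, G x ∂μ) ^ q := hGN f G hGm hfG
      _ ≤ C * (M * (1 + I)) ^ q := by gcongr
      _ = _ := by rw [ENNReal.mul_rpow_of_nonneg _ _ hq0, mul_assoc]
  set t : ℕ → ℝ := fun m => R / (m + 1) with ht
  have htpos : ∀ m, 0 < t m := fun m => by positivity
  have ht0 : Tendsto t atTop (𝓝 0) := by
    simpa [ht, Function.comp_def] using
      (tendsto_const_div_atTop_nhds_zero_nat R).comp (tendsto_add_atTop_nat 1)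
  -- The shift `t m` is `κ⁻¹` times the mollification radius `t m * κ`, so the off-centre
  -- differentiation theorem applies with constant `κ⁻¹`.
  have hconv := ae_tendsto_mollify_add hu.integrable (r := fun m => t m * κ)
    (fun m => mul_pos (htpos m) hκ) (by simpa using ht0.mul_const κ) (c := fun m => t m • ν)
    (K := κ⁻¹) (fun m => by
      rw [norm_smul, hν, mul_one, Real.norm_eq_abs, abs_of_pos (htpos m)]
      field_simp
      exact le_rfl)
  refine (lintegral_mono_ae (g := fun x => liminf (fun m =>
    ‖mollify μ (halfBump (t m * κ) (mul_pos (htpos m) hκ)) u (x + t m • ν)‖ₑ ^ q) atTop) ?_).trans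
    ((lintegral_liminf_le fun m => ?_).trans ?_)
  · filter_upwards [ae_restrict_of_ae hconv] with x hx
    exact ((ENNReal.continuous_rpow_const.tendsto _).comp hx.enorm).liminf_eq.ge
  · have hc : Continuous (mollify μ (halfBump (t m * κ) (mul_pos (htpos m) hκ)) u) :=
      (contDiff_mollify (n := 0) _ hu.integrable).continuous
    exact (hc.comp (continuous_add_const _)).measurable.enorm.pow_const _
  · exact liminf_le_of_frequently_le' (Frequently.of_forall fun m => hsmooth (t m) (htpos m)
      (div_le_self hR.le (by linarith [m.cast_nonneg (α := ℝ)])))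

theorem exists_sobolev (hn : 2 ≤ Module.finrank ℝ E) {U : Set E} (hUo : IsOpen U)
    (hUb : Bornology.IsBounded U) (hcone : UniformCone U)
    {q : ℝ} (hq : q = (Module.finrank ℝ E : ℝ) / (Module.finrank ℝ E - 1)) :
    ∃ C : ℝ≥0∞, C ≠ ∞ ∧ ∀ u, IsUnitVar μ U u →
      ∫⁻ x in U, ‖u x‖ₑ ^ q ∂μ ≤ C * (1 + ∫⁻ x, ‖u x‖ₑ ∂μ) ^ q := by
  have hcl : IsCompact (closure U) :=
    Metric.isCompact_of_isClosed_isBounded isClosed_closure hUb.closure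
  have h : ∃ C : ℝ≥0∞, C ≠ ∞ ∧ ∀ u, IsUnitVar μ U u →
      ∫⁻ x in U ∩ closure U, ‖u x‖ₑ ^ q ∂μ ≤ C * (1 + ∫⁻ x, ‖u x‖ₑ ∂μ) ^ q := by
    refine hcl.induction_on (p := fun s => ∃ C : ℝ≥0∞, C ≠ ∞ ∧ ∀ u, IsUnitVar μ U u →
      ∫⁻ x in U ∩ s, ‖u x‖ₑ ^ q ∂μ ≤ C * (1 + ∫⁻ x, ‖u x‖ₑ ∂μ) ^ q) ?_ ?_ ?_ fun x hx => ?_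
    · exact ⟨0, by simp, by simp⟩
    · rintro s t hst ⟨C, hC, h⟩
      exact ⟨C, hC, fun u hu =>
        (lintegral_mono_set (inter_subset_inter_right _ hst)).trans (h u hu)⟩
    · rintro s t ⟨C, hC, h⟩ ⟨C', hC', h'⟩
      refine ⟨C + C', ENNReal.add_ne_top.2 ⟨hC, hC'⟩, fun u hu => ?_⟩
      rw [add_mul, inter_union_distrib_left]
      exact (lintegral_union_le _ _ _).trans (add_le_add (h u hu) (h' u hu))
    · obtain ⟨ν, R, κ, hν, hR, hκ, hκ2, hc⟩ := hcone x hx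
      exact ⟨_, mem_nhdsWithin_of_mem_nhds (Metric.ball_mem_nhds x (by positivity)),
        exists_local_sobolev hn hUo hν hR hκ hκ2 hc hq⟩
  rwa [inter_eq_left.2 subset_closure] at h

/-- The Sobolev-Poincaré inequality with the critical exponent, for functions of bounded variation
and zero mean. -/
theorem exists_sobolev_poincare (hn : 2 ≤ Module.finrank ℝ E) {U : Set E} (hUo : IsOpen U)
    (hUb : Bornology.IsBounded U) (hUc : IsConnected U) (hcone : UniformCone U)
    {q : ℝ} (hq : q = (Module.finrank ℝ E : ℝ) / (Module.finrank ℝ E - 1)) :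
    ∃ C : ℝ≥0∞, C ≠ ∞ ∧ ∀ u, IsUnitVar μ U u → (∀ x ∉ U, u x = 0) → ∫ x, u x ∂μ = 0 →
      ∫⁻ x in U, ‖u x‖ₑ ^ q ∂μ ≤ C := by
  have hq0 : 0 ≤ q := by
    have : (2 : ℝ) ≤ Module.finrank ℝ E := by exact_mod_cast hn
    rw [hq]
    exact div_nonneg (by linarith) (by linarith)
  obtain ⟨C₁, hC₁, h₁⟩ := exists_lintegral_sub_const_le (μ := μ) hUo hUb hUc hcone
  obtain ⟨C, hC, h⟩ := exists_sobolev (μ := μ) hn hUo hUb hcone hq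
  refine ⟨C * (1 + (C₁ + C₁)) ^ q, ENNReal.mul_ne_top hC (ENNReal.rpow_ne_top_of_nonneg hq0
    (ENNReal.add_ne_top.2 ⟨by simp, ENNReal.add_ne_top.2 ⟨hC₁, hC₁⟩⟩)), fun u hu hout hmean => ?_⟩
  refine (h u hu).trans ?_
  gcongr
  obtain ⟨c, hc⟩ := h₁ u hu
  have hUfin : μ U ≠ ∞ := hUb.measure_lt_top.ne
  have hzero : ∫ x in U, u x ∂μ = 0 := by
    rw [setIntegral_eq_integral_of_forall_compl_eq_zero hout, hmean]
  -- Zero mean gives `|c| * μ U = |∫_U (u - c)| ≤ C₁`, so the `L¹` norm of `u` is at most `2 * C₁`.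
  have hcle : ‖c‖ₑ * μ U ≤ C₁ := by
    have h2 : ∫ x in U, (u x - c) ∂μ = -(c * μ.real U) := by
      rw [integral_sub hu.integrable.integrableOn (integrableOn_const hUfin), hzero,
        setIntegral_const, smul_eq_mul]
      ring
    calc ‖c‖ₑ * μ U = ‖∫ x in U, (u x - c) ∂μ‖ₑ := by
          rw [h2, enorm_neg, enorm_mul, measureReal_def, Real.enorm_of_nonneg ENNReal.toReal_nonneg,
            ENNReal.ofReal_toReal hUfin]
      _ ≤ _ := (enorm_integral_le_lintegral_enorm _).trans hc
  calc ∫⁻ x, ‖u x‖ₑ ∂μ = ∫⁻ x in U, ‖u x‖ₑ ∂μ := by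
        rw [← lintegral_indicator hUo.measurableSet]
        refine lintegral_congr fun x => ?_
        by_cases hx : x ∈ U
        · simp [hx]
        · simp [hx, hout x hx]
    _ ≤ ∫⁻ x in U, (‖u x - c‖ₑ + ‖c‖ₑ) ∂μ := by
        refine lintegral_mono fun x => ?_
        simpa using enorm_add_le (u x - c) c
    _ = ∫⁻ x in U, ‖u x - c‖ₑ ∂μ + ‖c‖ₑ * μ U := by
        rw [lintegral_add_right _ measurable_const, setLIntegral_const]
    _ ≤ C₁ + C₁ := add_le_add hc hcle

end Sobolev

/-! ### Krein-Milman for bounded closed convex sets in `L^q`. -/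

section KreinMilman

variable {α : Type*} [MeasurableSpace α] {μ : Measure α} [IsFiniteMeasure μ]

/-- On a bounded closed convex subset of `L^q`, `1 < q < ∞`, a continuous linear functional is
bounded by its values at the extreme points. -/
theorem le_of_forall_extremePoints_le {q q' : ℝ≥0∞} [Fact (1 ≤ q)] [Fact (1 ≤ q')]
    [ENNReal.HolderConjugate q q'] (hq : q ≠ ∞) (hq' : q' ≠ ∞) {B : Set (Lp ℝ q μ)}
    (hBc : IsClosed B) (hBv : Convex ℝ B) {M : ℝ} (hBb : ∀ u ∈ B, ‖u‖ ≤ M)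
    (ℓ : Lp ℝ q μ →L[ℝ] ℝ) {c : ℝ} (hℓ : ∀ u ∈ B.extremePoints ℝ, ℓ u ≤ c) :
    ∀ u ∈ B, ℓ u ≤ c := by
  have hsym : ENNReal.HolderConjugate q' q := ENNReal.HolderTriple.symm
  -- `Φ` identifies `L^q` with the dual of `L^{q'}`, so that Banach-Alaoglu supplies compactness in
  -- the weak-* topology.
  let Φ : Lp ℝ q μ →ₗ[ℝ] WeakDual ℝ (Lp ℝ q' μ) :=
    (StrongDual.toWeakDual : StrongDual ℝ (Lp ℝ q' μ) ≃ₗ[ℝ] _).toLinearMap ∘ₗ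
      (lpDuality μ q q').toLinearMap
  have hΦ : ∀ u g, Φ u g = lpDuality μ q' q g u := by
    intro u g
    change lpDuality μ q q' u g = _
    rw [lpDuality_apply, lpDuality_apply]
    simp_rw [mul_comm]
  have hrep : ∀ f : Lp ℝ q μ →L[ℝ] ℝ, ∃ g : Lp ℝ q' μ, ∀ u, f u = Φ u g := by
    intro f
    obtain ⟨g, hg⟩ := exists_lpDuality_eq (p := q) (q := q') hq hq' f
    exact ⟨g, fun u => by rw [hΦ, hg]⟩
  have hsurj : ∀ x : WeakDual ℝ (Lp ℝ q' μ), ∃ u, Φ u = x := by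
    intro x
    obtain ⟨u, hu⟩ := exists_lpDuality_eq (p := q') (q := q) hq' hq (WeakDual.toStrongDual x)
    exact ⟨u, congrArg StrongDual.toWeakDual hu⟩
  have hinj : Function.Injective Φ := by
    intro u v huv
    by_contra hne
    obtain ⟨f, hf⟩ := SeparatingDual.exists_separating_of_ne (R := ℝ) hne
    obtain ⟨g, hg⟩ := hrep f
    exact hf (by rw [hg, hg, huv])
  -- A point outside the image comes from some `u ∉ B`, by surjectivity of `Φ`. A functional
  -- separating `u` from `B` is evaluation at some `g`, hence weak-* continuous.
  have hcl : IsClosed (Φ '' B) := by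
    rw [← isOpen_compl_iff, isOpen_iff_mem_nhds]
    intro x hx
    obtain ⟨u, rfl⟩ := hsurj x
    have hu : u ∉ B := fun h => hx ⟨u, h, rfl⟩
    obtain ⟨f, s, hfB, hfu⟩ := geometric_hahn_banach_closed_point hBv hBc hu
    obtain ⟨g, hg⟩ := hrep f
    have ho : IsOpen {y : WeakDual ℝ (Lp ℝ q' μ) | s < y g} :=
      isOpen_lt continuous_const (WeakDual.eval_continuous g)
    refine mem_of_superset (ho.mem_nhds (show s < Φ u g by rwa [← hg])) ?_
    rintro y hy ⟨v, hv, rfl⟩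
    have h1 : s < Φ v g := hy
    rw [← hg] at h1
    exact (hfB v hv).not_gt h1
  have hcomp : IsCompact (Φ '' B) := by
    refine (WeakDual.isCompact_closedBall (𝕜 := ℝ) (E := Lp ℝ q' μ) 0
      (‖lpDuality μ q q'‖ * M)).of_isClosed_subset hcl ?_
    rintro _ ⟨u, hu, rfl⟩
    change lpDuality μ q q' u ∈ Metric.closedBall 0 _
    rw [mem_closedBall_zero_iff]
    exact ((lpDuality μ q q').le_opNorm u).trans
      (mul_le_mul_of_nonneg_left (hBb u hu) (norm_nonneg _))
  have hconv : Convex ℝ (Φ '' B) := hBv.linear_image Φ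
  obtain ⟨g, hg⟩ := hrep ℓ
  have : LocallyConvexSpace ℝ (WeakDual ℝ (Lp ℝ q' μ)) :=
    inferInstanceAs (LocallyConvexSpace ℝ (WeakBilin (topDualPairing ℝ (Lp ℝ q' μ))))
  have hKM := closure_convexHull_extremePoints hcomp hconv
  have hhalf : closure (convexHull ℝ ((Φ '' B).extremePoints ℝ)) ⊆ {y | y g ≤ c} := by
    refine closure_minimal (convexHull_min ?_ ?_)
      (isClosed_le (WeakDual.eval_continuous g) continuous_const)
    · intro y hy
      obtain ⟨u, hu, rfl⟩ := hy.1
      change Φ u g ≤ c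
      rw [← hg]
      refine hℓ u ⟨hu, fun v hv w hw hopen => ?_⟩
      refine hinj (hy.2 ⟨v, hv, rfl⟩ ⟨w, hw, rfl⟩ ?_)
      obtain ⟨a, b, ha, hb, hab, rfl⟩ := hopen
      exact ⟨a, b, ha, hb, hab, by simp⟩
    · intro y hy z hz a b ha hb hab
      change a * y g + b * z g ≤ c
      have h1 : y g ≤ c := hy
      have h2 : z g ≤ c := hz
      calc a * y g + b * z g ≤ a * c + b * c := by gcongr
        _ = c := by rw [← add_mul, hab, one_mul]
  intro u hu
  rw [hg]
  have : Φ u ∈ closure (convexHull ℝ ((Φ '' B).extremePoints ℝ)) := by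
    rw [hKM]; exact ⟨u, hu, rfl⟩
  exact hhalf this

end KreinMilman

/-! ### The cone condition for Lipschitz domains and the norm bound on the TV ball. -/

namespace LipschitzDomain

variable {d : ℕ} (Ω : LipschitzDomain d)

/-- At an interior point any direction serves. At a boundary point the axis is `-ν`, pointing into
the subgraph: moving by `s • v` lowers the height by at least `s * (1 - κ)`, while the graph can
drop by at most `2 * C * κ * s`. -/
theorem uniformCone (hd : 2 ≤ d) : UniformCone Ω.carrier := by
  intro x₀ hx₀
  by_cases hin : x₀ ∈ Ω.carrier
  · obtain ⟨ε, hε, hball⟩ := Metric.isOpen_iff.1 Ω.isOpen x₀ hin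
    have hν : ‖EuclideanSpace.single (⟨0, by omega⟩ : Fin d) (1 : ℝ)‖ = 1 := by simp
    refine ⟨EuclideanSpace.single (⟨0, by omega⟩ : Fin d) (1 : ℝ), ε / 4, 1 / 2, hν,
      by positivity, by norm_num, le_rfl, fun x _ hx v hv s hs0 hs => hball ?_⟩
    have hvn : ‖v‖ ≤ 2 := by
      have := norm_sub_norm_le v (EuclideanSpace.single (⟨0, by omega⟩ : Fin d) (1 : ℝ))
      linarith
    rw [Metric.mem_ball, dist_eq_norm, add_sub_right_comm]
    rw [dist_eq_norm] at hx
    have h1 : ‖s • v‖ ≤ ε / 4 * 2 := by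
      rw [norm_smul, Real.norm_eq_abs, abs_of_nonneg hs0]
      gcongr
    linarith [norm_add_le (x - x₀) (s • v)]
  · have hfr : x₀ ∈ frontier Ω.carrier := by
      rw [Ω.isOpen.frontier_eq]; exact ⟨hx₀, hin⟩
    obtain ⟨ν, g, C, hν, hg, hev⟩ := Ω.lipschitz_boundary x₀ hfr
    obtain ⟨δ, hδ, hball⟩ := Metric.eventually_nhds_iff.1 hev
    -- Chosen so that `2 * C * κ = 1/2 - κ`, which is less than `1 - κ`: the point descends faster
    -- than the graph.
    set κ : ℝ := 1 / (2 * (1 + 2 * C)) with hκ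
    have hC : (0 : ℝ) ≤ C := C.2
    have hκ0 : 0 < κ := by positivity
    have hκC : κ * (1 + 2 * C) = 1 / 2 := by rw [hκ]; field_simp
    have hκ2 : κ ≤ 1 / 2 := by nlinarith
    refine ⟨-ν, δ / 4, κ, by rw [norm_neg, hν], by positivity, hκ0, hκ2,
      fun x hxU hx v hv s hs0 hs => ?_⟩
    have hvn : ‖v‖ ≤ 2 := by
      have := norm_sub_norm_le v (-ν)
      rw [norm_neg] at this
      linarith
    have hdist : dist (x + s • v) x₀ < δ := by
      rw [dist_eq_norm, add_sub_right_comm]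
      rw [dist_eq_norm] at hx
      have h1 : ‖s • v‖ ≤ δ / 4 * 2 := by
        rw [norm_smul, Real.norm_eq_abs, abs_of_nonneg hs0]
        gcongr
      linarith [norm_add_le (x - x₀) (s • v)]
    rw [hball hdist]
    have hxg := (hball (by linarith : dist x x₀ < δ)).1 hxU
    set w := v - -ν with hw
    have hvw : v = w - ν := by rw [hw]; abel
    have hνν : inner ℝ ν ν = (1 : ℝ) := by rw [real_inner_self_eq_norm_sq, hν, one_pow]
    have hνw : |inner ℝ ν w| ≤ κ := by
      have := abs_real_inner_le_norm ν w
      rw [hν, one_mul] at this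
      exact this.trans hv
    set P : EuclideanSpace ℝ (Fin d) → EuclideanSpace ℝ (Fin d) :=
      fun y => y - (inner ℝ ν y : ℝ) • ν with hP
    have hinner : inner ℝ ν (x + s • v) = inner ℝ ν x + s * (inner ℝ ν w - 1) := by
      rw [hvw, inner_add_right, inner_smul_right, inner_sub_right, hνν]
    have hPd : P (x + s • v) - P x = s • (w - (inner ℝ ν w : ℝ) • ν) := by
      simp only [hP]
      rw [hinner, hvw]
      module
    have hPn : ‖P (x + s • v) - P x‖ ≤ s * (2 * κ) := by
      rw [hPd, norm_smul, Real.norm_eq_abs, abs_of_nonneg hs0]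
      gcongr
      refine (norm_sub_le _ _).trans ?_
      rw [norm_smul, hν, mul_one, Real.norm_eq_abs]
      linarith
    have hgl : g (P x) - g (P (x + s • v)) ≤ C * (s * (2 * κ)) := by
      have h1 := hg.dist_le_mul (P (x + s • v)) (P x)
      rw [dist_eq_norm (P (x + s • v)), Real.dist_eq] at h1
      have h2 := neg_le_abs (g (P (x + s • v)) - g (P x))
      have h3 := mul_le_mul_of_nonneg_left hPn hC
      linarith
    change inner ℝ ν (x + s • v) < g (P (x + s • v))
    have hxg' : inner ℝ ν x < g (P x) := hxg
    rw [hinner]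
    have h4 := (abs_le.1 hνw).2
    have h5 : s * (inner ℝ ν w - 1) ≤ s * (κ - 1) := by gcongr
    have h6 : C * (s * (2 * κ)) = s * (1 / 2 - κ) := by rw [← hκC]; ring
    nlinarith

theorem divergence_smul_const {g : EuclideanSpace ℝ (Fin d) → ℝ} (hg : ContDiff ℝ 1 g)
    (e x : EuclideanSpace ℝ (Fin d)) :
    divergence (fun x => g x • e) x = fderiv ℝ g x e := by
  have h : fderiv ℝ (fun x => g x • e) x = (fderiv ℝ g x).smulRight e :=
    (((hg.differentiable one_ne_zero) x).hasFDerivAt.smul_const e).fderiv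
  have he : e = ∑ i : Fin d, e i • EuclideanSpace.single i (1 : ℝ) := by
    ext j
    simp [Finset.sum_apply, Pi.single_apply]
  unfold divergence
  rw [h]
  conv_rhs => rw [he, map_sum]
  refine Finset.sum_congr rfl fun i _ => ?_
  simp [mul_comm]

theorem isTestField_smul_const {g : EuclideanSpace ℝ (Fin d) → ℝ} (hg : ContDiff ℝ 1 g)
    (hgc : HasCompactSupport g) (hgU : tsupport g ⊆ Ω.carrier) (hg1 : ∀ x, |g x| ≤ 1)
    {e : EuclideanSpace ℝ (Fin d)} (he : ‖e‖ ≤ 1) : Ω.IsTestField fun x => g x • e := by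
  refine ⟨hg.smul contDiff_const, hgc.smul_right, ?_, fun x => ?_⟩
  · refine (closure_mono ?_).trans hgU
    intro x hx h0
    exact hx (by simp [h0])
  · rw [norm_smul, Real.norm_eq_abs]
    exact mul_le_one₀ (hg1 x) (norm_nonneg _) he

variable {Ω}

theorem IsTestField.continuous_divergence {ψ : EuclideanSpace ℝ (Fin d) → EuclideanSpace ℝ (Fin d)}
    (hψ : Ω.IsTestField ψ) : Continuous (divergence ψ) := by
  unfold divergence
  refine continuous_finsetSum _ fun i _ => ?_
  have : Continuous fun x => fderiv ℝ ψ x (EuclideanSpace.single i 1) :=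
    (hψ.1.continuous_fderiv one_ne_zero).clm_apply continuous_const
  fun_prop

theorem IsTestField.exists_bound {ψ : EuclideanSpace ℝ (Fin d) → EuclideanSpace ℝ (Fin d)}
    (hψ : Ω.IsTestField ψ) : ∃ C, ∀ x, ‖divergence ψ x‖ ≤ C := by
  refine hψ.continuous_divergence.bounded_above_of_compact_support ?_
  refine (hψ.2.1.fderiv (𝕜 := ℝ)).mono fun x hx h0 => hx ?_
  simp [divergence, h0]

theorem tv_le_iff {u : EuclideanSpace ℝ (Fin d) → ℝ} {r : ℝ} :
    Ω.TV u ≤ r ↔ ∀ ψ, Ω.IsTestField ψ → ∫ x, u x * divergence ψ x ∂Ω.vol ≤ r := by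
  simp [TV, iSup_le_iff, EReal.coe_le_coe_iff]

variable {q : ℝ≥0∞} [Fact (1 ≤ q)]

/-- The functional `u ↦ ∫ u h` on `L^q(Ω)`, for a bounded function `h`. -/
theorem exists_clm_integral_mul {h : EuclideanSpace ℝ (Fin d) → ℝ} (hh : Continuous h)
    {C : ℝ} (hC : ∀ x, ‖h x‖ ≤ C) :
    ∃ L : Lp ℝ q Ω.vol →L[ℝ] ℝ, ∀ u, L u = ∫ x, u x * h x ∂Ω.vol := by
  have h1 : ENNReal.HolderConjugate q (ENNReal.conjExponent q) :=
    ENNReal.HolderConjugate.conjExponent Fact.out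
  have h2 : Fact (1 ≤ ENNReal.conjExponent q) := ⟨le_self_add⟩
  have hm : MemLp h (ENNReal.conjExponent q) Ω.vol :=
    MemLp.of_bound hh.aestronglyMeasurable C (ae_of_all _ hC)
  refine ⟨(lpDuality Ω.vol q (ENNReal.conjExponent q)).flip hm.toLp, fun u => ?_⟩
  rw [ContinuousLinearMap.flip_apply, lpDuality_apply]
  refine integral_congr_ae ?_
  filter_upwards [hm.coeFn_toLp] with x hx
  rw [hx]

/-- The fields `g • e` are admissible for TV and have divergence `∂_e g`, so TV dominates every
directional variation. -/
theorem isUnitVar_indicator {f : Lp ℝ q Ω.vol} (hf : Ω.TV f ≤ 1) :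
    IsUnitVar volume Ω.carrier (Ω.carrier.indicator f) := by
  have hm : MeasurableSet Ω.carrier := Ω.isOpen.measurableSet
  refine ⟨(Lp.stronglyMeasurable f).measurable.indicator hm, ?_, fun e he g hg hgc hgU hg1 => ?_⟩
  · rw [integrable_indicator_iff hm]
    exact ((Lp.memLp f).integrable Fact.out : Integrable f Ω.vol)
  · have h1 := (tv_le_iff (r := 1)).1 (by simpa using hf) _
      (Ω.isTestField_smul_const hg hgc hgU hg1 he)
    simp_rw [divergence_smul_const hg] at h1
    refine le_of_eq_of_le ?_ h1
    change _ = ∫ x in Ω.carrier, _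
    rw [← integral_indicator hm]
    congr 1
    ext x
    by_cases hx : x ∈ Ω.carrier <;> simp [hx]

/-- This is where connectedness and the Lipschitz boundary of the domain enter the theorem. -/
theorem exists_norm_le_of_tv_le (hd : 2 ≤ d)
    (hq : q = ENNReal.ofReal ((d : ℝ) / ((d : ℝ) - 1))) :
    ∃ M : ℝ, ∀ f : Lp ℝ q Ω.vol, Ω.TV f ≤ 1 → ∫ x, f x ∂Ω.vol = 0 → ‖f‖ ≤ M := by
  have hm : MeasurableSet Ω.carrier := Ω.isOpen.measurableSet
  have hd2 : (2 : ℝ) ≤ d := by exact_mod_cast hd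
  have hqr : 0 < (d : ℝ) / ((d : ℝ) - 1) := div_pos (by linarith) (by linarith)
  have hqt : q.toReal = (d : ℝ) / ((d : ℝ) - 1) := by rw [hq, ENNReal.toReal_ofReal hqr.le]
  have hqtop : q ≠ ∞ := by rw [hq]; exact ENNReal.ofReal_ne_top
  have hq0 : q ≠ 0 := (zero_lt_one.trans_le Fact.out).ne'
  obtain ⟨C, hC, h⟩ := exists_sobolev_poincare (μ := (volume : Measure (EuclideanSpace ℝ (Fin d))))
    (by simpa using hd) Ω.isOpen Ω.isBounded Ω.isConnected (Ω.uniformCone hd)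
    (q := q.toReal) (by rw [hqt]; simp)
  refine ⟨(C ^ (1 / q.toReal)).toReal, fun f hf hmean => ?_⟩
  have h1 := h _ (isUnitVar_indicator hf) (fun x hx => indicator_of_notMem hx _)
    (by rw [integral_indicator hm]; exact hmean)
  have h2 : ∫⁻ x, ‖f x‖ₑ ^ q.toReal ∂Ω.vol ≤ C := by
    refine le_of_eq_of_le ?_ h1
    exact setLIntegral_congr_fun hm fun x hx => by simp [hx]
  rw [Lp.norm_def]
  refine ENNReal.toReal_mono (ENNReal.rpow_ne_top_of_nonneg (by positivity) hC) ?_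
  rw [eLpNorm_eq_lintegral_rpow_enorm_toReal hq0 hqtop]
  gcongr

end LipschitzDomain

/-! ### First order inequalities from one-sided difference quotients. -/

theorem ConvexOn.fderiv_sub_le {Y : Type*} [NormedAddCommGroup Y] [NormedSpace ℝ Y] {F : Y → ℝ}
    (hF : ConvexOn ℝ univ F) {a : Y} (ha : DifferentiableAt ℝ F a) (b : Y) :
    fderiv ℝ F a (b - a) ≤ F b - F a := by
  have h := (ha.hasFDerivAt.hasLineDerivAt (b - a)).tendsto_slope_zero_right
  refine le_of_tendsto h ?_
  filter_upwards [Ioo_mem_nhdsGT (zero_lt_one' ℝ)] with t ht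
  have h1 := hF.2 (mem_univ a) (mem_univ b) (sub_nonneg.2 ht.2.le) ht.1.le (by ring)
  have h2 : (1 - t) • a + t • b = a + t • (b - a) := by module
  rw [h2] at h1
  simp only [smul_eq_mul] at h1
  rw [smul_eq_mul, inv_mul_le_iff₀ ht.1]
  linarith

theorem le_fderiv_of_forall_add_smul {Y : Type*} [NormedAddCommGroup Y] [NormedSpace ℝ Y]
    {F : Y → ℝ} {a v : Y} (ha : DifferentiableAt ℝ F a) {c : ℝ}
    (h : ∀ t : ℝ, 0 < t → t < 1 → F a + t * c ≤ F (a + t • v)) : c ≤ fderiv ℝ F a v := by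
  have h1 := (ha.hasFDerivAt.hasLineDerivAt v).tendsto_slope_zero_right
  refine ge_of_tendsto h1 ?_
  filter_upwards [Ioo_mem_nhdsGT (zero_lt_one' ℝ)] with t ht
  rw [smul_eq_mul, le_inv_mul_iff₀ ht.1]
  linarith [h t ht.1 ht.2]

/-! ### TV as a seminorm modulo constants, and the passage to extreme points. -/

namespace LipschitzDomain

variable {d : ℕ} {Ω : LipschitzDomain d}

/-- Each component has compact support, so its partial derivatives have integral zero. This is what
makes TV blind to constants. -/
theorem IsTestField.integral_divergence
    {ψ : EuclideanSpace ℝ (Fin d) → EuclideanSpace ℝ (Fin d)} (hψ : Ω.IsTestField ψ) :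
    ∫ x, divergence ψ x ∂Ω.vol = 0 := by
  have hzero : ∀ x ∉ Ω.carrier, divergence ψ x = 0 := by
    intro x hx
    have : fderiv ℝ ψ x = 0 := by
      by_contra h
      exact hx (hψ.2.2.1 (support_fderiv_subset ℝ h))
    simp [divergence, this]
  have h1 : ∫ x, divergence ψ x ∂Ω.vol = ∫ x, divergence ψ x :=
    setIntegral_eq_integral_of_forall_compl_eq_zero hzero
  have hcoord : ∀ (i : Fin d) x, fderiv ℝ ψ x (EuclideanSpace.single i 1) i =
      fderiv ℝ (fun y => ψ y i) x (EuclideanSpace.single i 1) := by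
    intro i x
    have h := ((EuclideanSpace.proj i : EuclideanSpace ℝ (Fin d) →L[ℝ] ℝ).hasFDerivAt.comp x
      ((hψ.1.differentiable one_ne_zero) x).hasFDerivAt).fderiv
    exact (congrArg (fun T : EuclideanSpace ℝ (Fin d) →L[ℝ] ℝ =>
      T (EuclideanSpace.single i 1)) h).symm
  have hci : ∀ i, ContDiff ℝ 1 fun y => ψ y i := fun i =>
    (EuclideanSpace.proj i : EuclideanSpace ℝ (Fin d) →L[ℝ] ℝ).contDiff.comp hψ.1
  have hcc : ∀ i, HasCompactSupport fun y => ψ y i := fun i =>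
    hψ.2.1.mono fun x hx h0 => hx (by simp [h0])
  rw [h1]
  simp_rw [divergence, hcoord]
  rw [integral_finsetSum]
  · exact Finset.sum_eq_zero fun i _ => integral_fderiv_eq_zero (hci i) (hcc i) _
  · intro i _
    refine Continuous.integrable_of_hasCompactSupport
      (((hci i).continuous_fderiv one_ne_zero).clm_apply continuous_const) ?_
    exact ((hcc i).fderiv (𝕜 := ℝ)).mono fun x hx h0 => hx (by simp [h0])

theorem tv_nonneg (u : EuclideanSpace ℝ (Fin d) → ℝ) : 0 ≤ Ω.TV u := by
  have h0 : Ω.IsTestField 0 :=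
    ⟨contDiff_zero_fun, HasCompactSupport.zero, by simp [tsupport], by simp⟩
  refine le_trans (le_of_eq ?_) (le_iSup₂ (f := fun ψ (_ : Ω.IsTestField ψ) =>
    ((∫ x, u x * divergence ψ x ∂Ω.vol : ℝ) : EReal)) 0 h0)
  simp [divergence]

variable {q : ℝ≥0∞} [Fact (1 ≤ q)]

theorem IsTestField.exists_clm {ψ : EuclideanSpace ℝ (Fin d) → EuclideanSpace ℝ (Fin d)}
    (hψ : Ω.IsTestField ψ) :
    ∃ L : Lp ℝ q Ω.vol →L[ℝ] ℝ, ∀ u, L u = ∫ x, u x * divergence ψ x ∂Ω.vol := by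
  obtain ⟨C, hC⟩ := hψ.exists_bound
  exact exists_clm_integral_mul hψ.continuous_divergence hC

theorem exists_clm_integral :
    ∃ L : Lp ℝ q Ω.vol →L[ℝ] ℝ, ∀ u, L u = ∫ x, u x ∂Ω.vol := by
  obtain ⟨L, hL⟩ := exists_clm_integral_mul (Ω := Ω) (q := q) (h := fun _ => 1) (C := 1)
    continuous_const (by simp)
  exact ⟨L, fun u => by simp [hL]⟩

theorem tv_add_le {f g : Lp ℝ q Ω.vol} {r s : ℝ} (hf : Ω.TV f ≤ r) (hg : Ω.TV g ≤ s) :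
    Ω.TV (f + g : Lp ℝ q Ω.vol) ≤ ((r + s : ℝ) : EReal) := by
  rw [tv_le_iff] at *
  intro ψ hψ
  obtain ⟨L, hL⟩ := hψ.exists_clm (q := q)
  rw [← hL, map_add, hL, hL]
  exact add_le_add (hf ψ hψ) (hg ψ hψ)

theorem tv_smul_le {f : Lp ℝ q Ω.vol} {r c : ℝ} (hc : 0 ≤ c) (hf : Ω.TV f ≤ r) :
    Ω.TV (c • f : Lp ℝ q Ω.vol) ≤ ((c * r : ℝ) : EReal) := by
  rw [tv_le_iff] at *
  intro ψ hψ
  obtain ⟨L, hL⟩ := hψ.exists_clm (q := q)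
  rw [← hL, map_smul, hL]
  exact mul_le_mul_of_nonneg_left (hf ψ hψ) hc

theorem tv_add_smul_const (f : Lp ℝ q Ω.vol) (c : ℝ) :
    Ω.TV (f + c • Lp.const q Ω.vol (1 : ℝ) : Lp ℝ q Ω.vol) = Ω.TV f := by
  unfold TV
  refine iSup_congr fun ψ => iSup_congr fun hψ => ?_
  obtain ⟨L, hL⟩ := hψ.exists_clm (q := q)
  have h1 : L (Lp.const q Ω.vol (1 : ℝ)) = 0 := by
    rw [hL, ← hψ.integral_divergence]
    refine integral_congr_ae ?_
    filter_upwards [Lp.coeFn_const (p := q) (μ := Ω.vol) (1 : ℝ)] with x hx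
    rw [hx, Function.const_apply, one_mul]
  rw [← hL, ← hL, map_add, map_smul, h1, smul_zero, add_zero]

variable {V : Submodule ℝ (Lp ℝ q Ω.vol)} (h1 : Lp.const q Ω.vol (1 : ℝ) ∈ V)

theorem tv_zero : Ω.TV ((0 : Lp ℝ q Ω.vol) : EuclideanSpace ℝ (Fin d) → ℝ) ≤ ((0 : ℝ) : EReal) := by
  rw [tv_le_iff]
  intro ψ hψ
  obtain ⟨L, hL⟩ := hψ.exists_clm (q := q)
  rw [← hL, map_zero]

theorem tv_add_smul_oneV (u : V) (c : ℝ) :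
    Ω.TV ((u + c • oneV h1 : V) : Lp ℝ q Ω.vol) = Ω.TV (u : Lp ℝ q Ω.vol) :=
  tv_add_smul_const _ _

omit [Fact (1 ≤ q)] in
theorem center_eq (u : V) :
    center h1 u = u + (-(⨍ x, (u : Lp ℝ q Ω.vol) x ∂Ω.vol)) • oneV h1 := by
  rw [center, neg_smul, sub_eq_add_neg]

theorem tv_center (u : V) : Ω.TV (center h1 u : Lp ℝ q Ω.vol) = Ω.TV (u : Lp ℝ q Ω.vol) := by
  rw [center_eq, tv_add_smul_oneV]

theorem integral_center (u : V) : ∫ x, (center h1 u : Lp ℝ q Ω.vol) x ∂Ω.vol = 0 := by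
  obtain ⟨L, hL⟩ := exists_clm_integral (Ω := Ω) (q := q)
  have hone : L (Lp.const q Ω.vol (1 : ℝ)) = Ω.vol.real univ := by
    rw [hL, integral_congr_ae (Lp.coeFn_const (p := q) (μ := Ω.vol) (1 : ℝ))]
    simp
  have hc : (center h1 u : Lp ℝ q Ω.vol) = (u : Lp ℝ q Ω.vol) -
      (⨍ x, (u : Lp ℝ q Ω.vol) x ∂Ω.vol) • Lp.const q Ω.vol (1 : ℝ) := rfl
  rw [← hL, hc, map_sub, map_smul, hone, hL, ← measure_smul_average Ω.vol, smul_eq_mul,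
    smul_eq_mul, mul_comm, sub_self]

theorem map_center {p : StrongDual ℝ V} (hp : p (oneV h1) = 0) (u : V) :
    p (center h1 u) = p u := by
  rw [center, map_sub, map_smul, hp, smul_zero, sub_zero]

include h1 in
/-- A functional bounded by one on the total variation unit ball and vanishing on the constants is
dominated by the total variation. -/
theorem le_of_forall_tvBall_le {p : StrongDual ℝ V} (hp : p (oneV h1) = 0)
    (hB : ∀ u ∈ tvBall V, p u ≤ 1) {u : V} {r : ℝ} (hu : Ω.TV (u : Lp ℝ q Ω.vol) ≤ r) :
    p u ≤ r := by
  have hr : 0 ≤ r := by exact_mod_cast (tv_nonneg _).trans hu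
  -- Normalizing by `r + ε` instead of `r` covers the case `r = 0`.
  refine le_of_forall_pos_le_add fun ε hε => ?_
  have hrε : 0 < r + ε := by linarith
  have hmem : (r + ε)⁻¹ • center h1 u ∈ tvBall V := by
    constructor
    · have h2 := tv_smul_le (f := (center h1 u : Lp ℝ q Ω.vol)) (r := r) (c := (r + ε)⁻¹)
        (by positivity) (by rwa [tv_center])
      refine h2.trans ?_
      have : (r + ε)⁻¹ * r ≤ 1 := by
        rw [inv_mul_le_iff₀ hrε]; linarith
      exact_mod_cast this
    · obtain ⟨L, hL⟩ := exists_clm_integral (Ω := Ω) (q := q)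
      rw [← hL, Submodule.coe_smul, map_smul, hL, integral_center, smul_zero]
  have h3 := hB _ hmem
  rw [map_smul, map_center h1 hp, smul_eq_mul, inv_mul_le_iff₀ hrε] at h3
  linarith

/-- A functional bounded by one at the extreme points of the total variation unit ball is bounded
by one on the ball. -/
theorem forall_tvBall_le_of_extremePoints (hd : 2 ≤ d)
    (hq : q = ENNReal.ofReal ((d : ℝ) / ((d : ℝ) - 1)))
    (hV : IsClosed (toWeakSpace ℝ (Lp ℝ q Ω.vol) '' (V : Set (Lp ℝ q Ω.vol))))
    (p : StrongDual ℝ V) (hp : ∀ u ∈ (tvBall V).extremePoints ℝ, p u ≤ 1) :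
    ∀ u ∈ tvBall V, p u ≤ 1 := by
  have hd2 : (2 : ℝ) ≤ d := by exact_mod_cast hd
  have hq1 : 1 < q := by
    rw [hq, ENNReal.one_lt_ofReal, one_lt_div (by linarith)]
    linarith
  have hqtop : q ≠ ∞ := by rw [hq]; exact ENNReal.ofReal_ne_top
  have hconj : ENNReal.HolderConjugate q (ENNReal.conjExponent q) :=
    ENNReal.HolderConjugate.conjExponent Fact.out
  have hfact : Fact (1 ≤ ENNReal.conjExponent q) := ⟨le_self_add⟩
  have hq'top : ENNReal.conjExponent q ≠ ∞ := by
    refine ENNReal.add_ne_top.2 ⟨ENNReal.one_ne_top, ENNReal.inv_ne_top.2 ?_⟩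
    exact (tsub_pos_of_lt hq1).ne'
  -- Weakly closed implies norm closed, since the identity into the weak topology is continuous.
  have hVc : IsClosed (V : Set (Lp ℝ q Ω.vol)) := by
    have h := hV.preimage (toWeakSpaceCLM ℝ (Lp ℝ q Ω.vol)).continuous
    have he : (toWeakSpaceCLM ℝ (Lp ℝ q Ω.vol)) ⁻¹'
        (toWeakSpace ℝ (Lp ℝ q Ω.vol) '' (V : Set (Lp ℝ q Ω.vol))) = V :=
      preimage_image_eq _ (toWeakSpace ℝ (Lp ℝ q Ω.vol)).injective
    rwa [he] at h
  obtain ⟨L, hL⟩ := exists_clm_integral (Ω := Ω) (q := q)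
  -- The ball is `V` cut by half-spaces, one for each test field, and by one hyperplane; closedness
  -- and convexity can be read off.
  have hset : Subtype.val '' tvBall V = (V : Set (Lp ℝ q Ω.vol)) ∩
      ({u | ∀ ψ, Ω.IsTestField ψ → ∫ x, u x * divergence ψ x ∂Ω.vol ≤ 1} ∩ {u | L u = 0}) := by
    ext u
    constructor
    · rintro ⟨v, hv, rfl⟩
      exact ⟨v.2, (tv_le_iff (r := 1)).1 (by simpa using hv.1), (hL _).trans hv.2⟩
    · rintro ⟨hu, h2, h3⟩
      exact ⟨⟨u, hu⟩, ⟨by simpa using (tv_le_iff (r := 1)).2 h2, (hL u).symm.trans h3⟩, rfl⟩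
  have hclosed : IsClosed (Subtype.val '' tvBall V) := by
    rw [hset]
    refine hVc.inter (IsClosed.inter ?_ (isClosed_eq L.continuous continuous_const))
    simp only [ofPred_forall]
    refine isClosed_iInter fun ψ => isClosed_iInter fun hψ => ?_
    obtain ⟨Lψ, hLψ⟩ := hψ.exists_clm (q := q)
    simp_rw [← hLψ]
    exact isClosed_le Lψ.continuous continuous_const
  have hconvex : Convex ℝ (Subtype.val '' tvBall V) := by
    rw [hset]
    refine V.convex.inter (Convex.inter ?_ ?_)
    · intro u hu v hv a b ha hb hab ψ hψ
      obtain ⟨Lψ, hLψ⟩ := hψ.exists_clm (q := q)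
      have h2 := hu ψ hψ
      have h3 := hv ψ hψ
      rw [← hLψ] at h2 h3 ⊢
      rw [map_add, map_smul, map_smul, smul_eq_mul, smul_eq_mul]
      calc a * Lψ u + b * Lψ v ≤ a * 1 + b * 1 := by gcongr
        _ = 1 := by rw [mul_one, mul_one, hab]
    · intro u hu v hv a b ha hb hab
      have h2 : L u = 0 := hu
      have h3 : L v = 0 := hv
      change L (a • u + b • v) = 0
      rw [map_add, map_smul, map_smul, h2, h3, smul_zero, smul_zero, add_zero]
  obtain ⟨M, hM⟩ := exists_norm_le_of_tv_le (Ω := Ω) hd hq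
  -- Hahn-Banach extends the functional from `V` to `L^q`, the space in which the Krein-Milman step
  -- takes place.
  obtain ⟨P, hP, -⟩ := exists_extension_norm_eq V p
  have hext : ∀ u ∈ (Subtype.val '' tvBall V).extremePoints ℝ, P u ≤ 1 := by
    rintro _ ⟨⟨u, hu, rfl⟩, hex⟩
    rw [hP]
    refine hp u ⟨hu, fun v hv w hw hopen => ?_⟩
    refine Subtype.ext (hex ⟨v, hv, rfl⟩ ⟨w, hw, rfl⟩ ?_)
    obtain ⟨a, b, ha, hb, hab, rfl⟩ := hopen
    exact ⟨a, b, ha, hb, hab, rfl⟩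
  intro u hu
  rw [← hP]
  refine le_of_forall_extremePoints_le hqtop hq'top hclosed hconvex (M := M) ?_ P hext _
    ⟨u, hu, rfl⟩
  rintro _ ⟨v, hv, rfl⟩
  exact hM _ hv.1 hv.2

/-! ### Optimality conditions. -/

section Optimality

variable {Y : Type*} [NormedAddCommGroup Y] [InnerProductSpace ℝ Y] [CompleteSpace Y]
  {F : Y → ℝ} {K : V →L[ℝ] Y} {ubar : V}

theorem dualVariable_apply (v : V) :
    dualVariable F K ubar v = -fderiv ℝ F (K ubar) (K v) := by
  change -(inner ℝ (gradient F (K ubar)) (K v)) = _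
  rw [gradient, InnerProductSpace.toDual_symm_apply]

-- Comparison with `u = 0` shows that TV is finite at a solution, so the optimality conditions can
-- be computed in `ℝ`.
omit [CompleteSpace Y] in
theorem IsSolution.exists_tv_eq (h : IsSolution F K ubar) :
    ∃ T : ℝ, Ω.TV (ubar : Lp ℝ q Ω.vol) = T := by
  have h0 := h 0
  have hne : Ω.TV (ubar : Lp ℝ q Ω.vol) ≠ ⊤ := by
    intro htop
    unfold objective at h0
    rw [htop, EReal.coe_add_top] at h0
    have h2 : ((F (K 0) : ℝ) : EReal) + Ω.TV ((0 : V) : Lp ℝ q Ω.vol) ≤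
        ((F (K 0) : ℝ) : EReal) + ((0 : ℝ) : EReal) := by
      gcongr
      exact tv_zero
    rw [← EReal.coe_add] at h2
    exact (EReal.coe_lt_top _).not_ge (h0.trans h2)
  have hbot : Ω.TV (ubar : Lp ℝ q Ω.vol) ≠ ⊥ :=
    ((EReal.bot_lt_zero).trans_le (tv_nonneg _)).ne'
  exact ⟨_, (EReal.coe_toReal hne hbot).symm⟩

/-- First order optimality condition. -/
theorem IsSolution.dualVariable_sub_le (h : IsSolution F K ubar)
    (hF : DifferentiableAt ℝ F (K ubar)) {T : ℝ} (hT : Ω.TV (ubar : Lp ℝ q Ω.vol) = T) {v : V}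
    {r : ℝ} (hv : Ω.TV (v : Lp ℝ q Ω.vol) ≤ r) :
    dualVariable F K ubar (v - ubar) ≤ r - T := by
  rw [dualVariable_apply]
  suffices h2 : T - r ≤ fderiv ℝ F (K ubar) (K (v - ubar)) by linarith
  -- Compare `ubar` with the convex combination `ubar + t • (v - ubar)`: convexity bounds the growth
  -- of TV linearly in `t`, and only `F` is differentiated.
  refine le_fderiv_of_forall_add_smul hF fun t ht0 ht1 => ?_
  have h3 : ubar + t • (v - ubar) = (1 - t) • ubar + t • v := by module
  have h4 : Ω.TV ((ubar + t • (v - ubar) : V) : Lp ℝ q Ω.vol) ≤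
      (((1 - t) * T + t * r : ℝ) : EReal) := by
    rw [h3]
    exact tv_add_le (tv_smul_le (sub_nonneg.2 ht1.le) hT.le) (tv_smul_le ht0.le hv)
  have h5 := h (ubar + t • (v - ubar))
  unfold objective at h5
  have h6 : ((F (K ubar) : ℝ) : EReal) + (T : EReal) ≤
      ((F (K (ubar + t • (v - ubar))) : ℝ) : EReal) + (((1 - t) * T + t * r : ℝ) : EReal) := by
    rw [← hT]
    exact h5.trans (add_le_add le_rfl h4)
  rw [← EReal.coe_add, ← EReal.coe_add, EReal.coe_le_coe_iff, map_add, map_smul] at h6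
  linarith

/-- Forward, the variational inequality is tested with competitors adapted to each condition.
Backward, `p ≤ TV` with equality at `ubar` is added to the gradient inequality of the convex
function `F`. -/
theorem isSolution_iff (hF : Differentiable ℝ F) (hFc : ConvexOn ℝ univ F) :
    IsSolution F K ubar ↔ dualVariable F K ubar (oneV h1) = 0 ∧
      ((dualVariable F K ubar ubar : ℝ) : EReal) = Ω.TV (ubar : Lp ℝ q Ω.vol) ∧
      ∀ u ∈ tvBall V, dualVariable F K ubar u ≤ 1 := by
  set p := dualVariable F K ubar with hp
  constructor
  · intro h
    obtain ⟨T, hT⟩ := h.exists_tv_eq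
    have key : ∀ {v : V} {r : ℝ}, Ω.TV (v : Lp ℝ q Ω.vol) ≤ r → p (v - ubar) ≤ r - T :=
      fun hv => h.dualVariable_sub_le (hF _) hT hv
    -- Adding constants to `ubar` leaves TV unchanged; both signs of `c` force `p` to vanish on
    -- constants.
    have hc : ∀ c : ℝ, c * p (oneV h1) ≤ 0 := by
      intro c
      have := key (v := ubar + c • oneV h1) (r := T) (by rw [tv_add_smul_oneV, hT])
      simpa using this
    refine ⟨le_antisymm (by simpa using hc 1) (by simpa using hc (-1)), ?_, fun u hu => ?_⟩
    -- The competitors `0` and `2 • ubar` give the two inequalities between `p ubar` and `T`.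
    · have h2 := key (v := 0) (r := 0) tv_zero
      have h3 := key (v := (2 : ℝ) • ubar) (r := 2 * T) (tv_smul_le zero_le_two hT.le)
      rw [zero_sub, map_neg] at h2
      rw [map_sub, map_smul, smul_eq_mul] at h3
      rw [hT, EReal.coe_eq_coe_iff]
      linarith
    -- Subadditivity of TV: adding an element of the ball raises TV by at most one.
    · have h2 := key (v := ubar + u) (r := T + 1) (tv_add_le hT.le (by simpa using hu.1))
      rw [add_sub_cancel_left] at h2
      linarith
  · rintro ⟨hone, hbar, hball⟩ v
    unfold objective
    rw [← hbar]
    by_cases htop : Ω.TV (v : Lp ℝ q Ω.vol) = ⊤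
    · rw [htop, EReal.coe_add_top]; exact le_top
    · have hbot : Ω.TV (v : Lp ℝ q Ω.vol) ≠ ⊥ :=
        ((EReal.bot_lt_zero).trans_le (tv_nonneg _)).ne'
      have hr := EReal.coe_toReal htop hbot
      set r := (Ω.TV (v : Lp ℝ q Ω.vol)).toReal
      have h2 := le_of_forall_tvBall_le h1 hone hball (u := v) (r := r) hr.ge
      have h3 := hFc.fderiv_sub_le (hF (K ubar)) (K v)
      rw [← map_sub] at h3
      have h4 : p (v - ubar) = -fderiv ℝ F (K ubar) (K (v - ubar)) := dualVariable_apply _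
      rw [map_sub] at h4
      rw [← hr, ← EReal.coe_add, ← EReal.coe_add, EReal.coe_le_coe_iff]
      linarith

end Optimality

end LipschitzDomain

theorem theorem2p5 {d : ℕ} (hd : 2 ≤ d) (Ω : LipschitzDomain d)
    {q : ℝ≥0∞} [Fact (1 ≤ q)] (hq : q = ENNReal.ofReal ((d : ℝ) / ((d : ℝ) - 1)))
    (V : Submodule ℝ (Lp ℝ q Ω.vol))
    (hV : IsClosed (toWeakSpace ℝ (Lp ℝ q Ω.vol) '' (V : Set (Lp ℝ q Ω.vol))))
    (h1 : Lp.const q Ω.vol (1 : ℝ) ∈ V)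
    {Y : Type*} [NormedAddCommGroup Y] [InnerProductSpace ℝ Y] [CompleteSpace Y]
    [TopologicalSpace.SeparableSpace Y]
    (K : V →L[ℝ] Y) (hK : LipschitzDomain.IsWeakToStrongContinuous K)
    (F : Y → ℝ) (hF_smooth : ContDiff ℝ 3 F) (hF_convex : StrictConvexOn ℝ Set.univ F)
    (hF_nonneg : ∀ y, 0 ≤ F y)
    (hF_min : ∀ y : Y, ∃! c : ℝ, ∀ c' : ℝ,
      F (y + c • K (LipschitzDomain.oneV h1)) ≤ F (y + c' • K (LipschitzDomain.oneV h1)))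
    (ubar : V) (pbar : StrongDual ℝ V) (hp : pbar = LipschitzDomain.dualVariable F K ubar) :
    List.TFAE [
      LipschitzDomain.IsSolution F K ubar,
      pbar (LipschitzDomain.oneV h1) = 0 ∧
        ((pbar ubar : ℝ) : EReal) = Ω.TV (ubar : Lp ℝ q Ω.vol) ∧
        ∀ u ∈ LipschitzDomain.tvBall V, pbar u ≤ 1,
      pbar (LipschitzDomain.oneV h1) = 0 ∧
        ((pbar (LipschitzDomain.center h1 ubar) : ℝ) : EReal) =
          Ω.TV (LipschitzDomain.center h1 ubar : Lp ℝ q Ω.vol) ∧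
        ∀ u ∈ (LipschitzDomain.tvBall V).extremePoints ℝ, pbar u ≤ 1] := by

  subst hp
  have hF : Differentiable ℝ F := hF_smooth.differentiable (by norm_num)
  tfae_have 1 ↔ 2 := LipschitzDomain.isSolution_iff h1 hF hF_convex.convexOn
  tfae_have 2 → 3 := fun ⟨hone, hbar, hball⟩ =>
    ⟨hone, by rw [LipschitzDomain.map_center h1 hone, LipschitzDomain.tv_center, hbar],
      fun u hu => hball u hu.1⟩
  tfae_have 3 → 2 := fun ⟨hone, hbar, hext⟩ =>
    ⟨hone, by rwa [LipschitzDomain.map_center h1 hone, LipschitzDomain.tv_center] at hbar,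
      LipschitzDomain.forall_tvBall_le_of_extremePoints hd hq hV _ hext⟩
  tfae_finish
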